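/- **Setting.** Let $\Sigma$ be a ranked alphabet (each symbol $f$ has a finite arity $\mathrm{ar}(f)$) and let $\Sigma_\bot=\Sigma\cup\{\bot\}$ with $\bot$ nullary. Let $\mathcal T$ be the set of finite and infinite $\Sigma_\bot$-labelled trees, ordered by $s\sqsubseteq t$ iff $t$ arises from $s$ by replacing $\bot$-labelled leaves by trees. Sorts are the simple types $\sigma ::= \iota \mid \sigma\to\sigma$. **Recursion schemes.** A deterministic higher-order recursion scheme (HoRS) $\mathcal G$ over $\Sigma$ consists of sorted nonterminals $F:\sigma$, a start symbol $S:\iota$ among them, and for each $F:\sigma_1\to\dots\to\sigma_m\to\iota$ exactly one rule $\mathcal R(F)=\lambda x_1\dots x_m.\,e$, where $e:\iota$ is a well-sorted applicative term over the nonterminals, the terminals $f:\iota^{\mathrm{ar}(f)}\to\iota$ with $f\in\Sigma$, and the variables $x_i:\sigma_i$. Interpret $\iota$ by the pointed dcpo $(\mathcal T,\sqsubseteq)$, $\sigma_1\to\sigma_2$ by the continuous functions with the pointwise order, a terminal $f$ by the function $(t_1,\dots,t_n)\mapsto f\,t_1\cdots t_n$, and application and abstraction as usual. The rules then define a continuous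 endofunction on valuations of the nonterminals, $\alpha\mapsto(F\mapsto[\![\mathcal R(F)]\!](\alpha))$. Let $[\![\mathcal G]\!]\in\mathcal T$ be the value at $S$ of its least fixpoint. **Logic programs.** Relational sorts are $\rho ::= o\mid\iota\to\rho\mid\rho\to\rho$. In the monotone sort frame, $\iota$ is interpreted by the set $\mathcal T$ with the discrete order, $o$ by $\{0\le1\}$, and $\to$ by monotone functions ordered pointwise. Goal terms are built from relational variables and first-order constraints over $\mathcal T$ (with the constructors in $\Sigma_\bot$ and equality) by $\wedge$, $\vee$, $\exists$ (over $\iota$ and relational sorts), application (to goal terms or first-order terms) and $\lambda$-abstraction, with the usual meaning. A program $P$ over $\Delta$ assigns to each relational variable $R:\Delta(R)$ a goal term $P(R):\Delta(R)$ over $\Delta$; its one-step consequence operator $T_P$ sends a valuation $\beta$ of $\Delta$ to $R\mapsto[\![P(R)]\!](\beta)$. It is a monotone endofunction of a complete lattice. **Encoding.** Let $\mathrm{Rel}^-(\iota)=\iota$, $\mathrm{Rel}^+(\iota)=\iota\to o$ and $\mathrm{Rel}^{\pm}(\sigma_1\to\sigma_2)=\mathrm{Rel}^-(\sigma_1)\to\mathrm{Rel}^+(\sigma_2)$.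 The encoding $P_{\mathcal G}$ has a relational variable $R_F:\mathrm{Rel}^+(\sigma)$ for each nonterminal $F:\sigma$, defined by $R_F=\overline{\mathcal R(F)}$, where $\overline{\lambda x_1\dots x_m.\,e}=\lambda x_1'\dots x_m'.\,\overline e$ with $x_i':\mathrm{Rel}^-(\sigma_i)$, and, for an applicative term $h\,e_1\cdots e_l:\sigma_1\to\dots\to\sigma_n\to\iota$ with head symbol $h$ and $e_i:\tau_i$, $$\overline{h\,e_1\cdots e_l}=\lambda y_1\dots y_n\,r.\ \exists r_1\dots r_l.\ \Bigl(h'\,a_1\cdots a_l\,y_1\cdots y_n\,r\ \wedge\ \bigwedge_{i=1}^{l} p_i\Bigr),\qquad y_j:\mathrm{Rel}^-(\sigma_j),\ r:\iota,\ r_i:\mathrm{Rel}^-(\tau_i).$$ Here $a_i=r_i$ and $p_i=\overline{e_i}\,r_i$ if $\tau_i=\iota$, while $a_i=\overline{e_i}$ and $p_i=\mathsf{true}$ otherwise; and $h'$ is $R_F$ if $h$ is a nonterminal $F$, is $\lambda x_1\dots x_k\,r.\,(f\,x_1\cdots x_k=r)$ if $h$ is a terminal $f$ of arity $k$, is $\lambda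 r.\,(x'=r)$ if $h$ is a variable $x:\iota$, and is $x'$ if $h$ is a variable $x$ of function sort. **Theorem (Correctness).** Let $\mathcal G$ be a deterministic HoRS such that no node of $[\![\mathcal G]\!]$ is labelled $\bot$. Let $\mathsf{gfp}(T_{P_{\mathcal G}})$ be the greatest fixpoint of the monotone one-step consequence operator of $P_{\mathcal G}$. Then for every $t\in\mathcal T$, $$[\![R_S]\!]\bigl(\mathsf{gfp}(T_{P_{\mathcal G}})\bigr)\,t=1\quad\Longleftrightarrow\quad t=[\![\mathcal G]\!].$$ -/

import Mathlib

/-! ## Ranked alphabets and trees -/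

/-- A ranked alphabet: symbols (tree constructors), each with a finite arity. -/
structure RankedAlphabet where
  Sym : Type
  arity : Sym → ℕ

/-- The alphabet `Σ_⊥ = Σ ∪ {⊥}`: `none` is the new nullary symbol `⊥`, and `some f` is `f ∈ Σ`. -/
abbrev RankedAlphabet.withBot (Sg : RankedAlphabet) : RankedAlphabet where
  Sym := Option Sg.Sym
  arity
    | none => 0
    | some f => Sg.arity f

/-- A finite or infinite tree over a ranked alphabet, as a labelled tree domain.  A node is the
list of child positions on the path leading to it from the root `[]`;
`lab w = none` means that `w` is not a node of the tree. -/
@[ext]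
structure RTree (S : RankedAlphabet) where
  lab : List ℕ → Option S.Sym
  root : (lab []).isSome
  child : ∀ w i, (lab (w ++ [i])).isSome ↔ ∃ f, lab w = some f ∧ i < S.arity f

/-- The tree `f t₁ … tₙ`. -/
def RTree.node {S : RankedAlphabet} (f : S.Sym) (ts : Fin (S.arity f) → RTree S) : RTree S where
  lab
    | [] => some f
    | i :: w => if h : i < S.arity f then (ts ⟨i, h⟩).lab w else none
  root := rfl
  child w i := by
    cases w with
    | nil =>
      by_cases h : i < S.arity f
      · simp [h, (ts ⟨i, h⟩).root]
      · simp [h]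
    | cons j w =>
      by_cases h : j < S.arity f
      · simpa [h] using (ts ⟨j, h⟩).child w i
      · simp [h]

/-- Finite and infinite `Σ_⊥`-labelled trees. -/
abbrev BTree (Sg : RankedAlphabet) := RTree Sg.withBot

namespace BTree

variable {Sg : RankedAlphabet}

/-- No node of the tree is labelled `⊥`. -/
def BotFree (t : BTree Sg) : Prop := ∀ w, t.lab w ≠ some none

theorem isSome_child (t : BTree Sg) (w : List ℕ) (i : ℕ) :
    (t.lab (w ++ [i])).isSome ↔ ∃ f : Sg.Sym, t.lab w = some (some f) ∧ i < Sg.arity f := by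
  rw [t.child]
  constructor
  · rintro ⟨f, hf, hi⟩
    cases f with
    | none => exact absurd hi (Nat.not_lt_zero i)
    | some f => exact ⟨f, hf, hi⟩
  · rintro ⟨f, hf, hi⟩
    exact ⟨some f, hf, hi⟩

/-- A `Σ_⊥`-tree is determined by its nodes with labels in `Σ`. -/
theorem ext_of_lab {s t : BTree Sg}
    (h : ∀ w (f : Sg.Sym), s.lab w = some (some f) ↔ t.lab w = some (some f)) : s = t := by
  have hs : ∀ w, (s.lab w).isSome ↔ (t.lab w).isSome := by
    intro w
    rcases List.eq_nil_or_concat w with rfl | ⟨u, i, rfl⟩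
    · simp [s.root, t.root]
    · rw [List.concat_eq_append, isSome_child, isSome_child]
      simp only [h]
  apply RTree.ext
  funext w
  have h1 := hs w
  have h2 := h w
  rcases hsw : s.lab w with _ | _ | f
  · rw [hsw] at h1
    rcases htw : t.lab w with _ | g
    · rfl
    · rw [htw] at h1
      simp at h1
  · rcases htw : t.lab w with _ | _ | g
    · rw [hsw, htw] at h1
      simp at h1
    · rfl
    · have := (h2 g).2 htw
      rw [hsw] at this
      simp at this
  · exact ((h2 f).1 hsw).symm

/-- The approximation order on `Σ_⊥`-trees: `s ⊑ t` iff `t` arises from `s` by replacing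
`⊥`-labelled leaves of `s` by trees. -/
instance : PartialOrder (BTree Sg) where
  le s t := ∀ w (f : Sg.Sym), s.lab w = some (some f) → t.lab w = some (some f)
  le_refl _ _ _ h := h
  le_trans _ _ _ h₁ h₂ w f h := h₂ w f (h₁ w f h)
  le_antisymm _ _ h₁ h₂ := ext_of_lab fun w f => ⟨h₁ w f, h₂ w f⟩

open Classical in
/-- The least upper bound of a directed set of trees. -/
noncomputable def directedSup (d : Set (BTree Sg)) (hd : DirectedOn (· ≤ ·) d) : BTree Sg where
  lab w :=
    if h : ∃ f : Sg.Sym, ∃ t ∈ d, t.lab w = some (some f) then some (some h.choose)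
    else if w = [] ∨ ∃ t ∈ d, t.lab w = some none then some none
    else none
  root := by
    split_ifs <;> simp_all
  child w i := by
    have key : ∀ (f g : Sg.Sym) (s t : BTree Sg), s ∈ d → t ∈ d → s.lab w = some (some f) →
        t.lab w = some (some g) → f = g := by
      intro f g s t hs ht hf hg
      obtain ⟨r, -, h1, h2⟩ := hd s hs t ht
      exact Option.some.inj (Option.some.inj ((h1 w f hf).symm.trans (h2 w g hg)))
    have lhs : ∀ v : List ℕ, v ≠ [] →
        ((if h : ∃ f : Sg.Sym, ∃ t ∈ d, t.lab v = some (some f) then some (some h.choose)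
          else if v = [] ∨ ∃ t ∈ d, t.lab v = some none then some none
          else none : Option (Option Sg.Sym)).isSome ↔ ∃ t ∈ d, (t.lab v).isSome) := by
      intro v hv
      split_ifs with h1 h2
      · obtain ⟨f, t, ht, h⟩ := h1
        simpa using ⟨t, ht, by simp [h]⟩
      · rcases h2 with h2 | ⟨t, ht, h⟩
        · exact absurd h2 hv
        · simpa using ⟨t, ht, by simp [h]⟩
      · simp only [Option.isSome_none, Bool.false_eq_true, false_iff]
        rintro ⟨t, ht, h⟩
        rcases htv : t.lab v with _ | _ | f
        · simp [htv] at h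
        · exact h2 (Or.inr ⟨t, ht, htv⟩)
        · exact h1 ⟨f, t, ht, htv⟩
    rw [show (_ : Prop) ↔ _ from lhs (w ++ [i]) (by simp)]
    constructor
    · rintro ⟨t, ht, h⟩
      obtain ⟨f, hf, hi⟩ := (isSome_child t w i).1 h
      have hex : ∃ f : Sg.Sym, ∃ t ∈ d, t.lab w = some (some f) := ⟨f, t, ht, hf⟩
      refine ⟨some f, ?_, hi⟩
      rw [dif_pos hex]
      obtain ⟨t', ht', hf'⟩ := hex.choose_spec
      rw [key _ _ _ _ ht' ht hf' hf]
    · rintro ⟨f, hf, hi⟩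
      split_ifs at hf with h1 h2
      · obtain ⟨t, ht, h⟩ := h1.choose_spec
        refine ⟨t, ht, (isSome_child t w i).2 ⟨_, h, ?_⟩⟩
        have hf' := Option.some.inj hf
        subst hf'
        exact hi
      · have hf' := Option.some.inj hf
        subst hf'
        exact absurd hi (Nat.not_lt_zero i)

theorem lab_directedSup (d : Set (BTree Sg)) (hd : DirectedOn (· ≤ ·) d) (w : List ℕ)
    (f : Sg.Sym) :
    (directedSup d hd).lab w = some (some f) ↔ ∃ t ∈ d, t.lab w = some (some f) := by
  by_cases h : ∃ f : Sg.Sym, ∃ t ∈ d, t.lab w = some (some f)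
  · have e : (directedSup d hd).lab w = some (some h.choose) := dif_pos h
    rw [e]
    obtain ⟨t, ht, h'⟩ := h.choose_spec
    constructor
    · intro hf
      rw [← hf]
      exact ⟨t, ht, h'⟩
    · rintro ⟨s, hs, hf⟩
      obtain ⟨r, -, h1, h2⟩ := hd s hs t ht
      exact (h2 w _ h').symm.trans (h1 w f hf)
  · have e : (directedSup d hd).lab w =
        (open Classical in if w = [] ∨ ∃ t ∈ d, t.lab w = some none then some none else none) :=
      dif_neg h
    rw [e]
    constructor
    · intro hf
      split_ifs at hf
      simp at hf
    · rintro ⟨s, hs, hf⟩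
      exact absurd ⟨f, s, hs, hf⟩ h

theorem isLUB_directedSup (d : Set (BTree Sg)) (hd : DirectedOn (· ≤ ·) d) :
    IsLUB d (directedSup d hd) := by
  constructor
  · intro t ht w f hf
    exact (lab_directedSup d hd w f).2 ⟨t, ht, hf⟩
  · intro u hu w f hf
    obtain ⟨t, ht, h⟩ := (lab_directedSup d hd w f).1 hf
    exact hu ht w f h

end BTree

/-! ## Pointed dcpos and continuous function spaces -/

open Classical in
/-- A partial order in which every directed set (also the empty one) has a least upper bound. -/
noncomputable abbrev cpoOfExists {α : Type} [PartialOrder α]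
    (h : ∀ d : Set α, DirectedOn (· ≤ ·) d → ∃ a, IsLUB d a) : CompletePartialOrder α :=
  letI : SupSet α :=
    ⟨fun d => if hd : DirectedOn (· ≤ ·) d then (h d hd).choose
      else (h ∅ (fun _ h => h.elim)).choose⟩
  CompletePartialOrder.ofLubOfDirected α fun d hd => by
    have e : sSup d = (h d hd).choose := dif_pos hd
    rw [e]
    exact (h d hd).choose_spec

noncomputable instance {Sg : RankedAlphabet} : CompletePartialOrder (BTree Sg) :=
  cpoOfExists fun d hd => ⟨_, BTree.isLUB_directedSup d hd⟩

/-- The space of (Scott-)continuous functions, ordered pointwise. -/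
def ContFun (α β : Type) [PartialOrder α] [PartialOrder β] : Type :=
  {f : α → β // ScottContinuous f}

namespace ContFun

instance {α β : Type} [PartialOrder α] [PartialOrder β] : CoeFun (ContFun α β) fun _ => α → β :=
  ⟨Subtype.val⟩

instance {α β : Type} [PartialOrder α] [PartialOrder β] : PartialOrder (ContFun α β) :=
  inferInstanceAs (PartialOrder {f : α → β // ScottContinuous f})

section

variable {α β γ : Type} [PartialOrder α] [PartialOrder β]

theorem isLUB_of_pointwise {d : Set (ContFun α β)} {g : ContFun α β}
    (h : ∀ x, IsLUB ((fun f : ContFun α β => f x) '' d) (g x)) : IsLUB d g := by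
  constructor
  · intro f hf x
    exact (h x).1 ⟨f, hf, rfl⟩
  · intro u hu x
    refine (h x).2 ?_
    rintro _ ⟨f, hf, rfl⟩
    exact hu hf x

theorem directedOn_eval {d : Set (ContFun α β)} (hd : DirectedOn (· ≤ ·) d) (x : α) :
    DirectedOn (· ≤ ·) ((fun f : ContFun α β => f x) '' d) := by
  rintro _ ⟨f, hf, rfl⟩ _ ⟨g, hg, rfl⟩
  obtain ⟨k, hk, h1, h2⟩ := hd f hf g hg
  exact ⟨k x, ⟨k, hk, rfl⟩, h1 x, h2 x⟩

end

section

variable {α β : Type} [PartialOrder α] [CompletePartialOrder β]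

theorem exists_pointwise_lub (d : Set (ContFun α β)) (hd : DirectedOn (· ≤ ·) d) :
    ∃ g : ContFun α β, ∀ x, IsLUB ((fun f : ContFun α β => f x) '' d) (g x) := by
  have hl := fun x : α => (directedOn_eval hd x).isLUB_sSup
  refine ⟨⟨fun x => sSup ((fun f : ContFun α β => f x) '' d), ?_⟩, hl⟩
  intro e hne he a ha
  constructor
  · rintro _ ⟨x, hx, rfl⟩
    refine (hl x).2 ?_
    rintro _ ⟨f, hf, rfl⟩
    exact (f.2.monotone (ha.1 hx)).trans ((hl a).1 ⟨f, hf, rfl⟩)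
  · intro u hu
    refine (hl a).2 ?_
    rintro _ ⟨f, hf, rfl⟩
    refine (f.2 hne he ha).2 ?_
    rintro _ ⟨x, hx, rfl⟩
    exact ((hl x).1 ⟨f, hf, rfl⟩).trans (hu ⟨x, hx, rfl⟩)

noncomputable instance : CompletePartialOrder (ContFun α β) :=
  cpoOfExists fun d hd =>
    let ⟨g, hg⟩ := exists_pointwise_lub d hd
    ⟨g, isLUB_of_pointwise hg⟩

/-- Application of continuous functions is jointly continuous. -/
theorem scottContinuous_apply :
    ScottContinuous fun p : ContFun α β × α => p.1 p.2 := by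
  refine ScottContinuous.fromProd (f := fun p : ContFun α β × α => p.1 p.2)
    (fun f => f.2) (fun x => ?_)
  intro d _ hd g hg
  obtain ⟨k, hk⟩ := exists_pointwise_lub d hd
  have e := hg.unique (isLUB_of_pointwise hk)
  subst e
  exact hk x

end

/-- Currying of continuous functions. -/
def curry {α β γ : Type} [PartialOrder α] [PartialOrder β] [CompletePartialOrder γ]
    (g : ContFun (α × β) γ) : ContFun α (ContFun β γ) :=
  ⟨fun a => ⟨fun b => g (a, b),
      ScottContinuous.comp (ScottContinuous.prodMk (ScottContinuous.const a) ScottContinuous.id)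
        g.2⟩, by
    intro d hne hd a ha
    refine isLUB_of_pointwise fun b => ?_
    have h : ScottContinuous fun a' => g (a', b) :=
      ScottContinuous.comp (ScottContinuous.prodMk ScottContinuous.id (ScottContinuous.const b)) g.2
    have := h hne hd ha
    have e := Set.image_image (fun f : ContFun β γ => f b)
      (fun a => (⟨fun b => g (a, b), ScottContinuous.comp (ScottContinuous.prodMk
        (ScottContinuous.const a) ScottContinuous.id) g.2⟩ : ContFun β γ)) d
    exact e ▸ this⟩

end ContFun

theorem scottContinuous_pi {α : Type} {I : Type} {π : I → Type} [PartialOrder α]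
    [∀ i, PartialOrder (π i)] {f : α → ∀ i, π i}
    (h : ∀ i, ScottContinuous fun a => f a i) : ScottContinuous f := by
  intro d hne hd a ha
  rw [isLUB_pi]
  intro i
  rw [Set.image_image]
  exact h i hne hd ha

theorem scottContinuous_eval {I : Type} {π : I → Type} [∀ i, PartialOrder (π i)] (i : I) :
    ScottContinuous fun f : (∀ i, π i) => f i := by
  intro d _ _ a ha
  exact (isLUB_pi.1 ha) i

theorem scottContinuous_eval₂ {I : Type} {J : I → Type} {π : I → Type}
    [∀ i, PartialOrder (π i)] (i : I) (x : J i) :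
    ScottContinuous fun f : (∀ i, J i → π i) => f i x := by
  intro d _ _ a ha
  have h := isLUB_pi.1 (isLUB_pi.1 ha i) x
  rw [Set.image_image] at h
  exact h

/-! ## Higher-order recursion schemes -/

/-- The sorts over the sort `ι` of individuals. -/
inductive HSort : Type
  | i : HSort
  | arr : HSort → HSort → HSort

/-- `ιⁿ → ι`. -/
def HSort.iotas : ℕ → HSort
  | 0 => .i
  | n + 1 => .arr .i (iotas n)

/-- Variables (de Bruijn indices) of sort `s` in a context. -/
inductive Var {K : Type} : List K → K → Type
  | zero {Γ : List K} {s : K} : Var (s :: Γ) s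
  | succ {Γ : List K} {s s' : K} : Var Γ s → Var (s' :: Γ) s

/-- Applicative terms over the nonterminals `NT` (given with their sorts), the terminals of `Sg`
and the variables of the context. -/
inductive HTerm (Sg : RankedAlphabet) (NT : HSort → Type) (Γ : List HSort) : HSort → Type
  | var {σ : HSort} : Var Γ σ → HTerm Sg NT Γ σ
  | term (f : Sg.Sym) : HTerm Sg NT Γ (HSort.iotas (Sg.arity f))
  | nonterm {σ : HSort} : NT σ → HTerm Sg NT Γ σ
  | app {a b : HSort} : HTerm Sg NT Γ (.arr a b) → HTerm Sg NT Γ a → HTerm Sg NT Γ b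

/-- Right-hand sides `λ x₁ … xₙ. t` of rewrite rules, where `t : ι` is an applicative term. -/
inductive HRule (Sg : RankedAlphabet) (NT : HSort → Type) : List HSort → HSort → Type
  | body {Γ : List HSort} : HTerm Sg NT Γ .i → HRule Sg NT Γ .i
  | lam {Γ : List HSort} {a b : HSort} : HRule Sg NT (a :: Γ) b → HRule Sg NT Γ (.arr a b)

/-- A deterministic higher-order recursion scheme over `Sg`: `NT σ` is the set of nonterminals of
sort `σ`, there is exactly one rule for each nonterminal, and the start symbol has sort `ι`. -/
structure HoRS (Sg : RankedAlphabet) where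
  NT : HSort → Type
  rule : ∀ {σ : HSort}, NT σ → HRule Sg NT [] σ
  start : NT .i

/-! ### Denotational semantics -/

/-- Interpretation of the sorts over `ι`: trees with the approximation order, and continuous
function spaces. -/
noncomputable def hdom (Sg : RankedAlphabet) : HSort → (α : Type) × CompletePartialOrder α
  | .i => ⟨BTree Sg, inferInstance⟩
  | .arr a b =>
    letI := (hdom Sg a).2
    letI := (hdom Sg b).2
    ⟨ContFun (hdom Sg a).1 (hdom Sg b).1, inferInstance⟩

/-- The domain in which sort `σ` is interpreted. -/
def HDom (Sg : RankedAlphabet) (σ : HSort) : Type := (hdom Sg σ).1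

noncomputable instance (Sg : RankedAlphabet) (σ : HSort) : CompletePartialOrder (HDom Sg σ) :=
  (hdom Sg σ).2

/-- Valuations of the variables of a context. -/
abbrev HEnv (Sg : RankedAlphabet) (Γ : List HSort) := ∀ σ, Var Γ σ → HDom Sg σ

/-- Valuations of the nonterminals. -/
abbrev NEnv (Sg : RankedAlphabet) (NT : HSort → Type) := ∀ σ, NT σ → HDom Sg σ

/-- Extension of a valuation by a value for the new variable. -/
def extendEnv {K : Type} {D : K → Type} {Γ : List K} {s : K} (γ : ∀ s', Var Γ s' → D s')
    (v : D s) : ∀ s', Var (s :: Γ) s' → D s'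
  | _, .zero => v
  | _, .succ x => γ _ x

theorem RTree.scottContinuous_node {Sg : RankedAlphabet} (f : Sg.Sym) :
    ScottContinuous fun ts : Fin (Sg.arity f) → BTree Sg =>
      (RTree.node (S := Sg.withBot) (some f) ts : BTree Sg) := by
  intro d hne hd a ha
  constructor
  · rintro _ ⟨ts, hts, rfl⟩ w g hg
    cases w with
    | nil => exact hg
    | cons j w =>
      by_cases h : j < Sg.withBot.arity (some f)
      · simp only [RTree.node, dif_pos h] at hg ⊢
        exact ha.1 hts ⟨j, h⟩ w g hg
      · simp [RTree.node, dif_neg h] at hg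
  · intro u hu w g hg
    cases w with
    | nil =>
      obtain ⟨ts, hts⟩ := hne
      exact hu ⟨ts, hts, rfl⟩ [] g hg
    | cons j w =>
      by_cases h : j < Sg.withBot.arity (some f)
      · simp only [RTree.node, dif_pos h] at hg
        have hj := isLUB_pi.1 ha ⟨j, h⟩
        have hdj : DirectedOn (· ≤ ·) (Function.eval (⟨j, h⟩ : Fin (Sg.arity f)) '' d) := by
          rintro _ ⟨x, hx, rfl⟩ _ ⟨y, hy, rfl⟩
          obtain ⟨z, hz, h1, h2⟩ := hd x hx y hy
          exact ⟨_, ⟨z, hz, rfl⟩, h1 _, h2 _⟩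
        have e := hj.unique (BTree.isLUB_directedSup _ hdj)
        rw [e] at hg
        obtain ⟨_, ⟨ts, hts, rfl⟩, ht⟩ := (BTree.lab_directedSup _ hdj w g).1 hg
        refine hu ⟨ts, hts, rfl⟩ (j :: w) g ?_
        simp only [RTree.node, dif_pos h]
        exact ht
      · simp [RTree.node, dif_neg h] at hg

/-- `n`-fold currying of a continuous function on trees. -/
noncomputable def curryTrees {Sg : RankedAlphabet} : (n : ℕ) → {E : Type} → [PartialOrder E] →
    ContFun (E × (Fin n → BTree Sg)) (BTree Sg) → ContFun E (HDom Sg (HSort.iotas n))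
  | 0, _, _, g =>
    ⟨fun e => g (e, Fin.elim0), ScottContinuous.comp
      (ScottContinuous.prodMk ScottContinuous.id (ScottContinuous.const _)) g.2⟩
  | n + 1, E, _, g =>
    ContFun.curry (α := E) (β := BTree Sg) (γ := HDom Sg (HSort.iotas n))
      (curryTrees n (E := E × BTree Sg)
        ⟨fun p => g (p.1.1, Fin.cons p.1.2 p.2), by
          refine ScottContinuous.comp (ScottContinuous.prodMk
            (ScottContinuous.comp ScottContinuous.fst ScottContinuous.fst)
            (scottContinuous_pi fun k => ?_)) g.2
          refine Fin.cases ?_ (fun k => ?_) k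
          · change ScottContinuous fun p : (E × BTree Sg) × (Fin n → BTree Sg) => p.1.2
            exact ScottContinuous.comp ScottContinuous.fst ScottContinuous.snd
          · change ScottContinuous fun p : (E × BTree Sg) × (Fin n → BTree Sg) => p.2 k
            exact ScottContinuous.comp ScottContinuous.snd (scottContinuous_eval k)⟩)

/-- The Herbrand interpretation `t₁ ↦ … ↦ tₙ ↦ f t₁ … tₙ` of a terminal `f`. -/
noncomputable def herbrand {Sg : RankedAlphabet} (f : Sg.Sym) :
    HDom Sg (HSort.iotas (Sg.arity f)) :=
  curryTrees (Sg.arity f) (E := Unit)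
    ⟨fun p => RTree.node (S := Sg.withBot) (some f) p.2,
      ScottContinuous.comp ScottContinuous.snd (RTree.scottContinuous_node f)⟩ ()

/-- Application in the interpretation of sorts. -/
noncomputable def HDom.app {Sg : RankedAlphabet} {a b : HSort} (f : HDom Sg (.arr a b))
    (x : HDom Sg a) : HDom Sg b :=
  (show ContFun (HDom Sg a) (HDom Sg b) from f) x

/-- Denotation of applicative terms. -/
noncomputable def HTerm.sem {Sg : RankedAlphabet} {NT : HSort → Type} {Γ : List HSort}
    (α : NEnv Sg NT) (γ : HEnv Sg Γ) : {σ : HSort} → HTerm Sg NT Γ σ → HDom Sg σ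
  | _, .var x => γ _ x
  | _, .term f => herbrand f
  | _, .nonterm F => α _ F
  | _, .app s t => (s.sem α γ).app (t.sem α γ)

theorem HTerm.scottContinuous_sem {Sg : RankedAlphabet} {NT : HSort → Type} {Γ : List HSort}
    {σ : HSort} (e : HTerm Sg NT Γ σ) :
    ScottContinuous fun p : NEnv Sg NT × HEnv Sg Γ => e.sem p.1 p.2 := by
  induction e with
  | @var σ x =>
    exact ScottContinuous.comp ScottContinuous.snd
      (scottContinuous_eval₂ σ x)
  | term f => exact ScottContinuous.const _
  | @nonterm σ F =>
    exact ScottContinuous.comp ScottContinuous.fst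
      (scottContinuous_eval₂ σ F)
  | @app a b s t ihs iht =>
    exact ScottContinuous.comp (ScottContinuous.prodMk ihs iht)
      (ContFun.scottContinuous_apply (α := HDom Sg a) (β := HDom Sg b))

/-- Denotation of right-hand sides, as a continuous function of the valuation. -/
noncomputable def HRule.sem {Sg : RankedAlphabet} {NT : HSort → Type} :
    {Γ : List HSort} → {σ : HSort} → HRule Sg NT Γ σ →
      ContFun (NEnv Sg NT × HEnv Sg Γ) (HDom Sg σ)
  | _, _, .body e => ⟨fun p => e.sem p.1 p.2, e.scottContinuous_sem⟩
  | Γ, _, .lam (a := a) (b := b) r =>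
    ContFun.curry (α := NEnv Sg NT × HEnv Sg Γ) (β := HDom Sg a) (γ := HDom Sg b)
      ⟨fun p => r.sem (p.1.1, extendEnv p.1.2 p.2), by
        refine ScottContinuous.comp (ScottContinuous.prodMk
          (ScottContinuous.comp ScottContinuous.fst ScottContinuous.fst)
          (scottContinuous_pi fun σ => scottContinuous_pi fun x => ?_)) r.sem.2
        cases x with
        | zero => exact ScottContinuous.snd
        | succ x =>
          exact ScottContinuous.comp ScottContinuous.fst (ScottContinuous.comp ScottContinuous.snd
            (scottContinuous_eval₂ σ x))⟩

/-- The empty valuation. -/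
def emptyEnv {K : Type} {D : K → Type} : ∀ s, Var ([] : List K) s → D s := fun _ x => nomatch x

namespace HoRS

variable {Sg : RankedAlphabet}

/-- The endofunction on valuations of the nonterminals given by the rewrite rules. -/
noncomputable def step (G : HoRS Sg) (α : NEnv Sg G.NT) : NEnv Sg G.NT :=
  fun _ F => (G.rule F).sem (α, emptyEnv)

theorem scottContinuous_step (G : HoRS Sg) : ScottContinuous G.step := by
  refine scottContinuous_pi fun σ => scottContinuous_pi fun F => ?_
  exact ScottContinuous.comp
    (ScottContinuous.prodMk ScottContinuous.id (ScottContinuous.const _)) (G.rule F).sem.2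

/-- The semantics of a scheme: the least fixpoint of `G.step`, as the supremum of the
Kleene chain `⊥ ⊑ step ⊥ ⊑ step (step ⊥) ⊑ …`. -/
noncomputable def lfp (G : HoRS Sg) : NEnv Sg G.NT :=
  fun σ F => ⨆ n : ℕ, (G.step^[n] ⊥) σ F

theorem isLUB_lfp (G : HoRS Sg) : IsLUB (Set.range fun n : ℕ => G.step^[n] ⊥) G.lfp := by
  have hm : Monotone fun n : ℕ => G.step^[n] ⊥ :=
    G.scottContinuous_step.monotone.monotone_iterate_of_le_map bot_le
  have hd : ∀ σ (F : G.NT σ), DirectedOn (· ≤ ·) (Set.range fun n : ℕ => (G.step^[n] ⊥) σ F) := by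
    intro σ F
    refine Directed.directedOn_range ?_
    exact Monotone.directed_le fun m n h => hm h σ F
  refine isLUB_pi.2 fun σ => isLUB_pi.2 fun F => ?_
  rw [← Set.range_comp, ← Set.range_comp]
  exact (hd σ F).isLUB_sSup

/-- `G.lfp` is the least fixpoint of `G.step`. -/
theorem isLeast_lfp (G : HoRS Sg) : IsLeast (Function.fixedPoints G.step) G.lfp := by
  have hm : Monotone fun n : ℕ => G.step^[n] ⊥ :=
    G.scottContinuous_step.monotone.monotone_iterate_of_le_map bot_le
  have h := G.isLUB_lfp
  constructor
  · have h' := G.scottContinuous_step (Set.range_nonempty _)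
      (Directed.directedOn_range (Monotone.directed_le hm)) h
    refine h'.unique ⟨?_, fun u hu => h.2 ?_⟩
    · rintro _ ⟨_, ⟨n, rfl⟩, rfl⟩
      refine h.1 ⟨n + 1, ?_⟩
      exact Function.iterate_succ_apply' G.step n ⊥
    · rintro _ ⟨n, rfl⟩
      refine (hm (Nat.le_succ n)).trans (hu ⟨_, ⟨n, rfl⟩, ?_⟩)
      exact (Function.iterate_succ_apply' G.step n ⊥).symm
  · intro β hβ
    refine h.2 ?_
    rintro _ ⟨n, rfl⟩
    induction n with
    | zero => exact bot_le
    | succ n ih =>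
      have := G.scottContinuous_step.monotone ih
      change G.step^[n + 1] ⊥ ≤ β
      rw [Function.iterate_succ_apply']
      exact this.trans (le_of_eq hβ)

/-- The tree generated by a scheme. -/
noncomputable def tree (G : HoRS Sg) : BTree Sg := G.lfp .i G.start

end HoRS

/-! ## Higher-order constrained Horn clauses -/

mutual

/-- Relational sorts `ρ ::= o | ι → ρ | ρ → ρ`. -/
inductive RSort : Type
  | o : RSort
  | arr : ASort → RSort → RSort

/-- Argument sorts: the sort `ι` of individuals, or a relational sort. -/
inductive ASort : Type
  | i : ASort
  | rel : RSort → ASort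

end

/-- The discrete order. -/
abbrev discreteOrder (A : Type) : PartialOrder A where
  le := Eq
  le_refl _ := rfl
  le_trans _ _ _ := Eq.trans
  le_antisymm _ _ h _ := h

mutual

/-- The monotone sort frame over a set `A` of individuals, at relational sorts: truth values with
`0 ≤ 1`, and monotone function spaces with the pointwise order. -/
def monoFrame (A : Type) : RSort → (α : Type) × CompleteLattice α
  | .o => ⟨Prop, inferInstance⟩
  | .arr s ρ =>
    letI := (monoFrameArg A s).2
    letI := (monoFrame A ρ).2
    ⟨(monoFrameArg A s).1 →o (monoFrame A ρ).1, inferInstance⟩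

/-- The monotone sort frame at argument sorts; individuals are ordered discretely. -/
def monoFrameArg (A : Type) : ASort → (α : Type) × PartialOrder α
  | .i => ⟨A, discreteOrder A⟩
  | .rel ρ =>
    letI := (monoFrame A ρ).2
    ⟨(monoFrame A ρ).1, inferInstance⟩

end

/-- The interpretation of a relational sort in the monotone sort frame. -/
def MDom (A : Type) (ρ : RSort) : Type := (monoFrame A ρ).1

/-- The interpretation of an argument sort in the monotone sort frame. -/
def MArg (A : Type) (s : ASort) : Type := (monoFrameArg A s).1

instance (A : Type) (ρ : RSort) : CompleteLattice (MDom A ρ) := (monoFrame A ρ).2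

instance (A : Type) (s : ASort) : PartialOrder (MArg A s) := (monoFrameArg A s).2

/-- Application in the monotone sort frame. -/
def MDom.app {A : Type} {s : ASort} {ρ : RSort} (f : MDom A (.arr s ρ)) (x : MArg A s) :
    MDom A ρ :=
  (show MArg A s →o MDom A ρ from f) x

/-- Goal terms `Δ, Γ ⊢ G : ρ` over a constraint language `L`, where `Δ` sorts the relational
variables of a program and `Γ` the remaining (bound) variables.  Constraints are first-order
formulas, and first-order terms are terms, over the individual variables in scope. -/
inductive Goal (L : FirstOrder.Language.{0, 0}) {V : Type} (Δ : V → RSort) : List ASort → RSort → Type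
  | constr {Γ : List ASort} (φ : L.Formula (Var Γ .i)) : Goal L Δ Γ .o
  | rvar {Γ : List ASort} (R : V) : Goal L Δ Γ (Δ R)
  | var {Γ : List ASort} {ρ : RSort} (x : Var Γ (.rel ρ)) : Goal L Δ Γ ρ
  | and {Γ : List ASort} (G H : Goal L Δ Γ .o) : Goal L Δ Γ .o
  | or {Γ : List ASort} (G H : Goal L Δ Γ .o) : Goal L Δ Γ .o
  | ex {Γ : List ASort} (s : ASort) (G : Goal L Δ (s :: Γ) .o) : Goal L Δ Γ .o
  | appInd {Γ : List ASort} {ρ : RSort} (G : Goal L Δ Γ (.arr .i ρ)) (N : L.Term (Var Γ .i)) :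
      Goal L Δ Γ ρ
  | appRel {Γ : List ASort} {ρ₁ ρ₂ : RSort} (G : Goal L Δ Γ (.arr (.rel ρ₁) ρ₂))
      (H : Goal L Δ Γ ρ₁) : Goal L Δ Γ ρ₂
  | lam {Γ : List ASort} (s : ASort) {ρ : RSort} (G : Goal L Δ (s :: Γ) ρ) :
      Goal L Δ Γ (.arr s ρ)

/-- Valuations of the relational variables of a program. -/
abbrev REnv (A : Type) {V : Type} (Δ : V → RSort) := ∀ R, MDom A (Δ R)

/-- Valuations of the variables of a context. -/
abbrev MEnv (A : Type) (Γ : List ASort) := ∀ s, Var Γ s → MArg A s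

theorem extendEnv_mono {A : Type} {Γ : List ASort} {s : ASort} {γ γ' : MEnv A Γ} {v v' : MArg A s}
    (h : γ ≤ γ') (hv : v ≤ v') :
    (extendEnv γ v : MEnv A (s :: Γ)) ≤ extendEnv γ' v' := by
  intro s' x
  cases x with
  | zero => exact hv
  | succ x => exact h _ x

/-- The individual variables of a valuation. -/
def MEnv.ind {A : Type} {Γ : List ASort} (γ : MEnv A Γ) : Var Γ .i → A := γ .i

theorem MEnv.ind_eq {A : Type} {Γ : List ASort} {γ γ' : MEnv A Γ} (h : γ ≤ γ') :
    γ.ind = γ'.ind :=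
  funext fun x => h .i x

/-- The (monotone) denotation of goal terms. -/
def Goal.sem {L : FirstOrder.Language.{0, 0}} (A : Type) [L.Structure A] {V : Type} {Δ : V → RSort} :
    {Γ : List ASort} → {ρ : RSort} → Goal L Δ Γ ρ → (REnv A Δ × MEnv A Γ →o MDom A ρ)
  | _, _, .constr φ =>
    { toFun := fun p => show Prop from φ.Realize (MEnv.ind p.2)
      monotone' := fun p q h => le_of_eq (congrArg φ.Realize (MEnv.ind_eq h.2)) }
  | _, _, .rvar R =>
    { toFun := fun p => p.1 R
      monotone' := fun _ _ h => h.1 R }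
  | _, _, .var x =>
    { toFun := fun p => p.2 _ x
      monotone' := fun _ _ h => h.2 _ x }
  | _, _, .and G H =>
    { toFun := fun p => G.sem A p ⊓ H.sem A p
      monotone' := fun _ _ h => inf_le_inf ((G.sem A).monotone h) ((H.sem A).monotone h) }
  | _, _, .or G H =>
    { toFun := fun p => G.sem A p ⊔ H.sem A p
      monotone' := fun _ _ h => sup_le_sup ((G.sem A).monotone h) ((H.sem A).monotone h) }
  | _, _, .ex s G =>
    { toFun := fun p => ⨆ v : MArg A s, G.sem A (p.1, extendEnv p.2 v)
      monotone' := fun _ _ h =>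
        iSup_mono fun _ => (G.sem A).monotone ⟨h.1, extendEnv_mono h.2 le_rfl⟩ }
  | _, _, .appInd G N =>
    { toFun := fun p => (G.sem A p).app (s := .i) (N.realize (M := A) (MEnv.ind p.2))
      monotone' := fun p q h => by
        have e := MEnv.ind_eq h.2
        have h' := (G.sem A).monotone h
        change (G.sem A p).app (s := .i) (N.realize (M := A) (MEnv.ind p.2)) ≤
          (G.sem A q).app (s := .i) (N.realize (M := A) (MEnv.ind q.2))
        rw [e]
        exact h' _ }
  | _, _, .appRel (ρ₁ := ρ₁) (ρ₂ := ρ₂) G H =>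
    { toFun := fun p => (G.sem A p).app (s := .rel ρ₁) (H.sem A p)
      monotone' := fun p q h =>
        le_trans (α := MDom A ρ₂) ((G.sem A).monotone h _)
          (OrderHom.monotone (show MArg A (.rel ρ₁) →o MDom A ρ₂ from G.sem A q)
            ((H.sem A).monotone h)) }
  | Γ, _, .lam s (ρ := ρ) G =>
    { toFun := fun p => show MArg A s →o MDom A ρ from
        { toFun := fun v => G.sem A (p.1, extendEnv p.2 v)
          monotone' := fun _ _ h => (G.sem A).monotone ⟨le_rfl, extendEnv_mono le_rfl h⟩ }
      monotone' := fun _ _ h v => (G.sem A).monotone ⟨h.1, extendEnv_mono h.2 le_rfl⟩ }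

/-- A constrained logic program over `Δ`: one defining equation `R = P R` for each relational
variable `R` of `Δ`. -/
abbrev LogicProgram (L : FirstOrder.Language.{0, 0}) {V : Type} (Δ : V → RSort) := ∀ R, Goal L Δ [] (Δ R)

/-- The monotone one-step consequence operator of a program. -/
def LogicProgram.oneStep {L : FirstOrder.Language.{0, 0}} (A : Type) [L.Structure A] {V : Type}
    {Δ : V → RSort} (P : LogicProgram L Δ) : REnv A Δ →o REnv A Δ where
  toFun β := fun R => (P R).sem A (β, emptyEnv)
  monotone' := fun _ _ h R => ((P R).sem A).monotone ⟨h, le_rfl⟩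

/-! ## The encoding of schemes as logic programs -/

/-- The first-order language with the symbols of `S` as function symbols (and equality). -/
def treeLang (S : RankedAlphabet) : FirstOrder.Language.{0, 0} where
  Functions n := {f : S.Sym // S.arity f = n}
  Relations _ := Empty

/-- The standard model: finite and infinite trees, with the tree constructors. -/
instance (S : RankedAlphabet) : (treeLang S).Structure (RTree S) where
  funMap f ts := RTree.node f.1 fun k => ts (Fin.cast f.2 k)
  RelMap r := nomatch r

mutual

/-- `Rel⁺`. -/
def relPos : HSort → RSort
  | .i => .arr .i .o
  | .arr a b => .arr (relNeg a) (relPos b)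

/-- `Rel⁻`. -/
def relNeg : HSort → ASort
  | .i => .i
  | .arr a b => .rel (.arr (relNeg a) (relPos b))

end

section Lift

variable {Sg : RankedAlphabet} {V : Type} {Δ : V → RSort}

/-- The context `Γ` extended by `y₁ : Rel⁻(σ₁), …, yₙ : Rel⁻(σₙ), r : ι`,
for `σ = σ₁ → … → σₙ → ι`. -/
def etaCtx : HSort → List ASort → List ASort
  | .i, Γ => .i :: Γ
  | .arr a b, Γ => etaCtx b (relNeg a :: Γ)

/-- Weakening of variables along the extension `etaCtx`. -/
def etaWk : (σ : HSort) → {Γ : List ASort} → {s : ASort} → Var Γ s → Var (etaCtx σ Γ) s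
  | .i, _, _, x => .succ x
  | .arr _ b, _, _, x => etaWk b (.succ x)

/-- The variable `r` in `etaCtx`. -/
def etaRes : (σ : HSort) → {Γ : List ASort} → Var (etaCtx σ Γ) .i
  | .i, _ => .zero
  | .arr _ b, _ => etaRes b

/-- The variables `y₁, …, yₙ` in `etaCtx`, if all of them are individual variables. -/
def etaInd : (n : ℕ) → {Γ : List ASort} → Fin n → Var (etaCtx (HSort.iotas n) Γ) .i
  | 0, _, k => k.elim0
  | n + 1, _, k => Fin.cases (etaWk (HSort.iotas n) .zero) (fun k => etaInd n k) k

/-- The abstraction `λ y₁ … yₙ r. G`. -/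
def etaLam {L : FirstOrder.Language.{0, 0}} :
    (σ : HSort) → {Γ : List ASort} → Goal L Δ (etaCtx σ Γ) .o → Goal L Δ Γ (relPos σ)
  | .i, _, G => .lam .i G
  | .arr a b, _, G => .lam (relNeg a) (etaLam b G)

/-- Application of `G : Rel⁺(a → b)` to a variable `x : Rel⁻(a)`. -/
def appVar {L : FirstOrder.Language.{0, 0}} {Γ : List ASort} :
    (a b : HSort) → Goal L Δ Γ (relPos (.arr a b)) → Var Γ (relNeg a) → Goal L Δ Γ (relPos b)
  | .i, _, G, x => .appInd G (.var x)
  | .arr _ _, _, G, x => .appRel G (.var x)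

/-- The application `G y₁ … yₙ r`, where `ξ` locates the variables `y₁, …, yₙ, r`. -/
def etaApp {L : FirstOrder.Language.{0, 0}} : (σ : HSort) → {Γ Γ' : List ASort} →
    (ξ : ∀ s, Var (etaCtx σ Γ) s → Var Γ' s) → Goal L Δ Γ' (relPos σ) → Goal L Δ Γ' .o
  | .i, _, _, ξ, G => .appInd G (.var (ξ _ .zero))
  | .arr a b, _, _, ξ, G => etaApp b ξ (appVar a b G (ξ _ (etaWk b .zero)))

/-- The goal term `D_f = λ x₁ … xₙ r. (f x₁ … xₙ = r)`. -/
def symGoal {Γ : List ASort} (f : Sg.Sym) :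
    Goal (treeLang Sg.withBot) Δ Γ (relPos (HSort.iotas (Sg.arity f))) :=
  etaLam _ (.constr (FirstOrder.Language.Term.equal
    (FirstOrder.Language.Term.func (L := treeLang Sg.withBot) (l := Sg.arity f) ⟨some f, rfl⟩
      fun k => .var (etaInd _ k))
    (.var (etaRes _))))

/-- The goal term that stands for a variable: `D_{x'} = λ r. (x' = r)` at sort `ι`, and `x'` at
function sorts. -/
def varGoal {L : FirstOrder.Language.{0, 0}} {Γ : List ASort} :
    (σ : HSort) → Var Γ (relNeg σ) → Goal L Δ Γ (relPos σ)
  | .i, x => .lam .i (.constr (FirstOrder.Language.Term.equal (.var (.succ x)) (.var .zero)))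
  | .arr _ _, x => .var x

/-- The goal `true`. -/
def trueGoal {L : FirstOrder.Language.{0, 0}} {Γ : List ASort} : Goal L Δ Γ .o := .constr ⊤

/-- The application of `G` to `⟦(e, r)⟧`, which is `r` if `e : ι`, and is the lift `E` of `e`
otherwise. -/
def appLift {L : FirstOrder.Language.{0, 0}} {Γ : List ASort} : (a b : HSort) →
    Goal L Δ Γ (relPos (.arr a b)) → Goal L Δ Γ (relPos a) → Var Γ (relNeg a) →
    Goal L Δ Γ (relPos b)
  | .i, _, G, _, r => .appInd G (.var r)
  | .arr _ _, _, G, E, _ => .appRel G E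

/-- `Prop(e, r)`, which is `E r` for the lift `E` of `e` if `e : ι`, and is `true` otherwise. -/
def propLift {L : FirstOrder.Language.{0, 0}} {Γ : List ASort} : (a : HSort) →
    Goal L Δ Γ (relPos a) → Var Γ (relNeg a) → Goal L Δ Γ .o
  | .i, E, r => .appInd E (.var r)
  | .arr _ _, _, _ => trueGoal

variable {NT : HSort → Type} {Γ : List HSort}

/-- For `e = $ e₁ … eₗ` with `eᵢ : τᵢ`, the context extended by
`r₁ : Rel⁻(τ₁), …, rₗ : Rel⁻(τₗ)`. -/
def exCtx : {σ : HSort} → HTerm Sg NT Γ σ → List ASort → List ASort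
  | _, .app (a := a) s _, Γ' => relNeg a :: exCtx s Γ'
  | _, .var _, Γ' => Γ'
  | _, .term _, Γ' => Γ'
  | _, .nonterm _, Γ' => Γ'

/-- Weakening of variables along the extension `exCtx`. -/
def exWk : {σ : HSort} → (e : HTerm Sg NT Γ σ) → {Γ' : List ASort} → (s : ASort) →
    Var Γ' s → Var (exCtx e Γ') s
  | _, .app s _, _, _, x => .succ (exWk s _ x)
  | _, .var _, _, _, x => x
  | _, .term _, _, _, x => x
  | _, .nonterm _, _, _, x => x

/-- Choices, in a context `Γ'`, of the variables `r₁ : Rel⁻(τ₁), …, rₗ : Rel⁻(τₗ)` for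
`e = $ e₁ … eₗ`. -/
def ArgVars (Γ' : List ASort) : {σ : HSort} → HTerm Sg NT Γ σ → Type
  | _, .app (a := a) s _ => ArgVars Γ' s × Var Γ' (relNeg a)
  | _, .var _ => Unit
  | _, .term _ => Unit
  | _, .nonterm _ => Unit

/-- The image of such a choice under a map of contexts. -/
def ArgVars.map {Γ₁ Γ₂ : List ASort} (ξ : ∀ s, Var Γ₁ s → Var Γ₂ s) :
    {σ : HSort} → (e : HTerm Sg NT Γ σ) → ArgVars Γ₁ e → ArgVars Γ₂ e
  | _, .app s _, r => (ArgVars.map ξ s r.1, ξ _ r.2)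
  | _, .var _, _ => ()
  | _, .term _, _ => ()
  | _, .nonterm _, _ => ()

/-- The variables `r₁, …, rₗ` in `exCtx`. -/
def exVars : {σ : HSort} → (e : HTerm Sg NT Γ σ) → (Γ' : List ASort) → ArgVars (exCtx e Γ') e
  | _, .app s _, Γ' => (ArgVars.map (fun _ x => .succ x) s (exVars s Γ'), .zero)
  | _, .var _, _ => ()
  | _, .term _, _ => ()
  | _, .nonterm _, _ => ()

/-- The existential quantification `∃ r₁ … rₗ. G`. -/
def exAll {L : FirstOrder.Language.{0, 0}} : {σ : HSort} → (e : HTerm Sg NT Γ σ) →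
    {Γ' : List ASort} → Goal L Δ (exCtx e Γ') .o → Goal L Δ Γ' .o
  | _, .app (a := a) s _, _, G => exAll s (.ex (relNeg a) G)
  | _, .var _, _, G => G
  | _, .term _, _, G => G
  | _, .nonterm _, _, G => G

end Lift

section Encoding

variable {Sg : RankedAlphabet} {NT : HSort → Type} {Γ : List HSort}

/-- The sort environment `Δ_G`: a relational variable `R_F : Rel⁺(σ)` for each nonterminal
`F : σ`. -/
def relEnv (NT : HSort → Type) : (Σ σ : HSort, NT σ) → RSort := fun F => relPos F.1

/-- Goal terms over trees and the relational variables `R_F`. -/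
abbrev TreeGoal (Sg : RankedAlphabet) (NT : HSort → Type) :=
  Goal (treeLang Sg.withBot) (relEnv NT)

/-- The choice of a relational clone `x' : Rel⁻(τ)` for each variable `x : τ` of a scheme. -/
abbrev Clones (Γ : List HSort) (Γ' : List ASort) := ∀ τ, Var Γ τ → Var Γ' (relNeg τ)

/-- The lift of `e = $ e₁ … eₗ`, i.e.
`λ y₁ … yₙ r. ∃ r₁ … rₗ. ($' ⟦(e₁, r₁)⟧ … ⟦(eₗ, rₗ)⟧ y₁ … yₙ r ∧ Prop(e₁, r₁) ∧ … ∧ Prop(eₗ, rₗ))`.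
The argument `core` produces, from the clones `x'` and the variables `r₁, …, rₗ` in any context, the
terms `$' ⟦(e₁, r₁)⟧ … ⟦(eₗ, rₗ)⟧` and `Prop(e₁, r₁) ∧ … ∧ Prop(eₗ, rₗ)`. -/
def closeLift {σ : HSort} (e : HTerm Sg NT Γ σ)
    (core : (Γ'' : List ASort) → Clones Γ Γ'' → ArgVars Γ'' e →
      TreeGoal Sg NT Γ'' (relPos σ) × TreeGoal Sg NT Γ'' .o)
    {Γ' : List ASort} (ξ : Clones Γ Γ') : TreeGoal Sg NT Γ' (relPos σ) :=
  let c := core (exCtx e (etaCtx σ Γ')) (fun τ x => exWk e _ (etaWk σ (ξ τ x))) (exVars e _)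
  etaLam σ (exAll e (.and (etaApp σ (exWk e) c.1) c.2))

/-- For `e = $ e₁ … eₗ`, the goal terms `$' ⟦(e₁, r₁)⟧ … ⟦(eₗ, rₗ)⟧` and
`Prop(e₁, r₁) ∧ … ∧ Prop(eₗ, rₗ)`. -/
def liftCore : {σ : HSort} → (e : HTerm Sg NT Γ σ) → (Γ' : List ASort) → Clones Γ Γ' →
    ArgVars Γ' e → TreeGoal Sg NT Γ' (relPos σ) × TreeGoal Sg NT Γ' .o
  | _, .app (a := a) (b := b) s e, Γ', ξ, r =>
    let c := liftCore s Γ' ξ r.1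
    let E := closeLift e (liftCore e) ξ
    (appLift a b c.1 E r.2, .and c.2 (propLift a E r.2))
  | σ, .var x, _, ξ, _ => (varGoal σ (ξ _ x), trueGoal)
  | _, .term f, _, _, _ => (symGoal f, trueGoal)
  | σ, .nonterm F, _, _, _ => (.rvar (Δ := relEnv NT) ⟨σ, F⟩, trueGoal)

/-- The relational lift of applicative terms. -/
def HTerm.lift {σ : HSort} (e : HTerm Sg NT Γ σ) {Γ' : List ASort} (ξ : Clones Γ Γ') :
    TreeGoal Sg NT Γ' (relPos σ) :=
  closeLift e (liftCore e) ξ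

/-- The relational lift of right-hand sides: the lift of `λ x₁ … xₘ. e` is
`λ x'₁ … x'ₘ. E` for the lift `E` of `e`. -/
def HRule.lift : {Γ : List HSort} → {σ : HSort} → HRule Sg NT Γ σ → {Γ' : List ASort} →
    Clones Γ Γ' → TreeGoal Sg NT Γ' (relPos σ)
  | _, _, .body e, _, ξ => e.lift ξ
  | _, _, .lam (a := a) r, _, ξ =>
    .lam (relNeg a) (r.lift fun
      | _, .zero => .zero
      | _, .succ x => .succ (ξ _ x))

namespace HoRS

/-- The encoding `P_G : Δ_G` of a scheme as a logic program: `R_F` is defined by the relational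
lift of the right-hand side of the rule for `F`. -/
def encoding (G : HoRS Sg) : LogicProgram (treeLang Sg.withBot) (relEnv G.NT) :=
  fun F => (G.rule F.2).lift fun _ x => nomatch x

/-- The relational variable `R_S` of the start symbol, as a goal term. -/
def startGoal (G : HoRS Sg) : TreeGoal Sg G.NT [] (.arr .i .o) :=
  .rvar (Δ := relEnv G.NT) ⟨.i, G.start⟩

end HoRS

end Encoding

-- Two logical relations, both instances of `BaseRel`, tie values of the scheme to values of its
-- encoding. At sort `ι` a positive occurrence matches a tree `d` with a set of trees, a negative
-- one with a single tree. In `below`, `d` is a lower bound of the set; in `mem`, `d` is an element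
-- of it.
--
-- Once the goal-term denotation of a lift is computed by recursion on the term (`liftSem`,
-- `HTerm.sem_lift`), one fundamental lemma serves both relations: related valuations stay related
-- after one step on each side (`posRel_step`).
--
-- With `below`, induction along the Kleene chain relates every approximant to the greatest
-- fixpoint, so each tree satisfying `R_S` lies above the tree of the scheme; as that tree has no
-- `⊥`, it is maximal and the two coincide. With `mem`, the relation is closed under infima, so the
-- valuation of least relations related to the least fixpoint is itself related to it. It is a
-- post-fixpoint of the one-step operator and hence lies below the greatest fixpoint, which puts the
-- tree of the scheme into `R_S`.

/-! ## The monotone sort frame -/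

section MonotoneFrame

variable {A : Type}

theorem MDom.ext {s : ASort} {ρ : RSort} {f g : MDom A (.arr s ρ)}
    (h : ∀ x : MArg A s, f.app x = g.app x) : f = g :=
  OrderHom.ext (α := MArg A s) (β := MDom A ρ) f g (funext h)

theorem MDom.iSup_app {I : Sort*} {s : ASort} {ρ : RSort} (f : I → MDom A (.arr s ρ))
    (x : MArg A s) : (⨆ i, f i).app x = ⨆ i, (f i).app x :=
  OrderHom.iSup_apply (α := MArg A s) (β := MDom A ρ) f x

theorem MDom.sInf_app {s : ASort} {ρ : RSort} (S : Set (MDom A (.arr s ρ)))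
    (x : MArg A s) : (sInf S).app x = ⨅ f ∈ S, f.app x :=
  OrderHom.sInf_apply (α := MArg A s) (β := MDom A ρ) S x

/-- The proposition denoted by a truth value of the monotone sort frame. -/
def MDom.Holds (p : MDom A .o) : Prop := p

theorem MDom.holds_iSup {I : Sort*} (p : I → MDom A .o) :
    (⨆ i, p i).Holds ↔ ∃ i, (p i).Holds :=
  iff_of_eq (iSup_Prop_eq (p := p))

/-- Application at the sorts `Rel⁺(a → b)` and `Rel⁻(a)`. -/
def relApp {a b : HSort} (R : MDom A (relPos (.arr a b))) (x : MArg A (relNeg a)) :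
    MDom A (relPos b) :=
  MDom.app (s := relNeg a) (ρ := relPos b) R x

/-- Application of a predicate on individuals. -/
def predApp (R : MDom A (relPos .i)) (t : A) : Prop :=
  MDom.app (s := .i) (ρ := .o) R t

theorem relPos_ext {R S : MDom A (relPos .i)} (h : ∀ t, predApp R t ↔ predApp S t) : R = S :=
  MDom.ext (s := .i) (ρ := .o) fun t => propext (h t)

theorem relPos_arr_ext {a b : HSort} {R S : MDom A (relPos (.arr a b))}
    (h : ∀ x : MArg A (relNeg a), relApp R x = relApp S x) : R = S :=
  MDom.ext (s := relNeg a) (ρ := relPos b) h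

theorem predApp_iSup {I : Sort*} (R : I → MDom A (relPos .i)) (t : A) :
    predApp (⨆ i, R i) t ↔ ∃ i, predApp (R i) t :=
  (iff_of_eq (MDom.iSup_app (s := .i) (ρ := .o) R t)).trans (MDom.holds_iSup _)

theorem relApp_iSup {I : Sort*} {a b : HSort} (R : I → MDom A (relPos (.arr a b)))
    (x : MArg A (relNeg a)) : relApp (⨆ i, R i) x = ⨆ i, relApp (R i) x :=
  MDom.iSup_app (s := relNeg a) (ρ := relPos b) R x

theorem predApp_sInf (S : Set (MDom A (relPos .i))) (t : A) :
    predApp (sInf S) t ↔ ∀ R ∈ S, predApp R t := by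
  refine (iff_of_eq (MDom.sInf_app (s := .i) (ρ := .o) S t)).trans ?_
  refine (iff_of_eq (iInf_Prop_eq (p := fun R : MDom A (relPos .i) =>
    (⨅ _ : R ∈ S, predApp R t : Prop)))).trans (forall_congr' fun R => ?_)
  exact iff_of_eq iInf_Prop_eq

theorem relApp_sInf {a b : HSort} (S : Set (MDom A (relPos (.arr a b))))
    (x : MArg A (relNeg a)) : relApp (sInf S) x = sInf ((fun R => relApp R x) '' S) :=
  (MDom.sInf_app (s := relNeg a) (ρ := relPos b) S x).trans sInf_image.symm

/-- A predicate on individuals, as an element of the monotone sort frame. -/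
def MDom.ofPred (p : A → Prop) : MDom A (.arr .i .o) :=
  -- Individuals are ordered by equality, so every predicate on them is monotone.
  show MArg A .i →o MDom A .o from ⟨p, fun _ _ h => le_of_eq (congrArg p h)⟩

/-- A function from individuals, as an element of the monotone sort frame. -/
def MDom.ofFun {ρ : RSort} (f : A → MDom A ρ) : MDom A (.arr .i ρ) :=
  show MArg A .i →o MDom A ρ from ⟨f, fun _ _ h => le_of_eq (congrArg f h)⟩

end MonotoneFrame

/-! ## Semantics of abstraction, application and quantification over blocks of variables -/

section Eta

variable {A : Type}

/-- The application of `R : Rel⁺(σ)` to the values of the variables `y₁, …, yₙ, r`. -/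
def fullApp : (σ : HSort) → {Γ : List ASort} → MDom A (relPos σ) → MEnv A (etaCtx σ Γ) → Prop
  | .i, _, R, γ => predApp R (γ _ .zero)
  | .arr _ b, _, R, γ => fullApp b (relApp R (γ _ (etaWk b .zero))) γ

/-- Suprema in the frame are pointwise, so they become existentials once all arguments are supplied.
This is what matches the `⨆` in `liftSem` with the `∃ r₁ … rₗ` of the encoding. -/
theorem fullApp_iSup {I : Sort*} (σ : HSort) {Γ : List ASort} (R : I → MDom A (relPos σ))
    (γ : MEnv A (etaCtx σ Γ)) : fullApp σ (⨆ i, R i) γ ↔ ∃ i, fullApp σ (R i) γ := by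
  induction σ generalizing Γ with
  | i => exact predApp_iSup R _
  | arr a b _ ihb =>
    change fullApp b (relApp (⨆ i, R i) _) γ ↔ _
    rw [relApp_iSup]
    exact ihb _ γ

variable {L : FirstOrder.Language.{0, 0}} [L.Structure A] {V : Type} {Δ : V → RSort}

/-- By extensionality an element of `Rel⁺(σ)` is determined by its truth values on full argument
lists, that is, on the valuations of `etaCtx σ Γ` that agree with `γ` on the old variables. -/
theorem sem_etaLam (σ : HSort) {Γ : List ASort} (G : Goal L Δ (etaCtx σ Γ) .o) (β : REnv A Δ)
    (γ : MEnv A Γ) (R : MDom A (relPos σ))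
    (h : ∀ γ' : MEnv A (etaCtx σ Γ), (∀ s (x : Var Γ s), γ' s (etaWk σ x) = γ s x) →
      (((G.sem A (β, γ')).Holds) ↔ fullApp σ R γ')) :
    (etaLam σ G).sem A (β, γ) = R := by
  induction σ generalizing Γ with
  | i =>
    exact relPos_ext fun t => h (extendEnv γ (show MArg A .i from t)) fun _ _ => rfl
  | arr a b _ ihb =>
    refine relPos_arr_ext fun x => ?_
    refine ihb G (extendEnv γ x) _ fun γ' hγ' => ?_
    have e : γ' _ (etaWk b .zero) = x := hγ' _ .zero
    subst e
    exact h γ' fun s y => hγ' s (.succ y)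

theorem sem_appVar (a b : HSort) {Γ : List ASort} (G : Goal L Δ Γ (relPos (.arr a b)))
    (x : Var Γ (relNeg a)) (β : REnv A Δ) (γ : MEnv A Γ) :
    (appVar a b G x).sem A (β, γ) =
      relApp (G.sem A (β, γ)) (γ _ x) := by
  cases a <;> rfl

/-- The map `ξ` is needed because the variables `y₁, …, yₙ, r` are used beneath the quantifiers `∃
r₁ … rₗ`, in a larger context than the one binding them. -/
theorem sem_etaApp (σ : HSort) {Γ Γ' : List ASort} (ξ : ∀ s, Var (etaCtx σ Γ) s → Var Γ' s)
    (G : Goal L Δ Γ' (relPos σ)) (β : REnv A Δ) (γ : MEnv A Γ') :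
    ((etaApp σ ξ G).sem A (β, γ)).Holds ↔
      fullApp σ (G.sem A (β, γ)) fun s x => γ s (ξ s x) := by
  induction σ generalizing Γ with
  | i => exact Iff.rfl
  | arr a b _ ihb =>
    refine (ihb (Γ := relNeg a :: Γ) ξ _).trans ?_
    rw [sem_appVar]
    rfl

end Eta

-- Blocks of existential quantifiers

section Quantifiers

variable {A : Type} {Sg : RankedAlphabet} {NT : HSort → Type} {Γ : List HSort}

/-- Values for the variables `r₁, …, rₗ` that belong to `e = $ e₁ … eₗ`. -/
def ArgVals (A : Type) : {σ : HSort} → HTerm Sg NT Γ σ → Type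
  | _, .app (a := a) s _ => ArgVals A s × MArg A (relNeg a)
  | _, .var _ => Unit
  | _, .term _ => Unit
  | _, .nonterm _ => Unit

/-- The values of the chosen variables `r₁, …, rₗ`. -/
def ArgVars.vals {Γ' : List ASort} (γ : MEnv A Γ') :
    {σ : HSort} → (e : HTerm Sg NT Γ σ) → ArgVars Γ' e → ArgVals A e
  | _, .app s _, r => (ArgVars.vals γ s r.1, γ _ r.2)
  | _, .var _, _ => ()
  | _, .term _, _ => ()
  | _, .nonterm _, _ => ()

/-- Extension of a valuation by values for `r₁, …, rₗ`. -/
def exEnv : {σ : HSort} → (e : HTerm Sg NT Γ σ) → {Γ' : List ASort} → MEnv A Γ' →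
    ArgVals A e → MEnv A (exCtx e Γ')
  | _, .app s _, _, γ, v => extendEnv (exEnv s γ v.1) v.2
  | _, .var _, _, γ, _ => γ
  | _, .term _, _, γ, _ => γ
  | _, .nonterm _, _, γ, _ => γ

/-- Together with `vals_exVars`: the extended valuation is `γ` on the old variables and `v` on the
quantified ones. -/
theorem exEnv_exWk {σ : HSort} (e : HTerm Sg NT Γ σ) {Γ' : List ASort} (γ : MEnv A Γ')
    (v : ArgVals A e) (s : ASort) (x : Var Γ' s) : exEnv e γ v s (exWk e s x) = γ s x := by
  induction e with
  | app s e ihs _ => exact ihs v.1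
  | var => rfl
  | term => rfl
  | nonterm => rfl

theorem ArgVars.vals_map {Γ₁ Γ₂ : List ASort} (ξ : ∀ s, Var Γ₁ s → Var Γ₂ s) (γ : MEnv A Γ₂)
    {σ : HSort} (e : HTerm Sg NT Γ σ) (r : ArgVars Γ₁ e) :
    (ArgVars.map ξ e r).vals γ = r.vals (fun s x => γ s (ξ s x)) := by
  induction e with
  | app s e ihs _ => exact Prod.ext (ihs r.1) rfl
  | var => rfl
  | term => rfl
  | nonterm => rfl

theorem vals_exVars {σ : HSort} (e : HTerm Sg NT Γ σ) {Γ' : List ASort} (γ : MEnv A Γ')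
    (v : ArgVals A e) : (exVars e Γ').vals (exEnv e γ v) = v := by
  induction e with
  | app s e ihs _ =>
    refine Prod.ext ?_ rfl
    exact (ArgVars.vals_map _ _ s _).trans (ihs v.1)
  | var => rfl
  | term => rfl
  | nonterm => rfl

variable {L : FirstOrder.Language.{0, 0}} [L.Structure A] {V : Type} {Δ : V → RSort}

theorem sem_exAll {σ : HSort} (e : HTerm Sg NT Γ σ) {Γ' : List ASort}
    (G : Goal L Δ (exCtx e Γ') .o) (β : REnv A Δ) (γ : MEnv A Γ') :
    ((exAll e G).sem A (β, γ)).Holds ↔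
      ∃ v : ArgVals A e, ((G.sem A (β, exEnv e γ v)).Holds) := by
  induction e with
  | app s e ihs _ =>
    refine (ihs _).trans ?_
    constructor
    · rintro ⟨v, h⟩
      obtain ⟨w, h⟩ := (MDom.holds_iSup (A := A) _).1 h
      exact ⟨(v, w), h⟩
    · rintro ⟨⟨v, w⟩, h⟩
      exact ⟨v, (MDom.holds_iSup (A := A) _).2 ⟨w, h⟩⟩
  | var => exact ⟨fun h => ⟨(), h⟩, fun ⟨_, h⟩ => h⟩
  | term => exact ⟨fun h => ⟨(), h⟩, fun ⟨_, h⟩ => h⟩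
  | nonterm => exact ⟨fun h => ⟨(), h⟩, fun ⟨_, h⟩ => h⟩

end Quantifiers

/-! ## Compositional semantics of the relational lift -/

section LiftSem

variable {Sg : RankedAlphabet} {NT : HSort → Type} {Γ : List HSort}

/-- `n`-fold currying of a function of `n` individuals. -/
def curryInd {A : Type} : (n : ℕ) → ((Fin n → A) → MDom A (.arr .i .o)) →
    MDom A (relPos (HSort.iotas n))
  | 0, h => h Fin.elim0
  | n + 1, h => MDom.ofFun (ρ := relPos (HSort.iotas n)) fun x =>
      curryInd n fun xs => h (Fin.cons x xs)

theorem fullApp_curryInd {A : Type} (n : ℕ) (h : (Fin n → A) → MDom A (.arr .i .o))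
    {Γ : List ASort} (γ : MEnv A (etaCtx (HSort.iotas n) Γ)) :
    fullApp (HSort.iotas n) (curryInd n h) γ ↔
      predApp (h fun k => γ .i (etaInd n k)) (γ _ (etaRes _)) := by
  induction n generalizing Γ with
  | zero =>
    have e : (fun k => γ .i (etaInd 0 k)) = Fin.elim0 := funext fun k => k.elim0
    rw [e]
    rfl
  | succ n ih =>
    refine (ih _ (Γ := .i :: Γ) γ).trans ?_
    -- Both `etaInd` and `curryInd` peel off the first argument, so the tuple of values is split at
    -- its head.
    have e : (fun k => γ .i (etaInd (n + 1) k) : Fin (n + 1) → A) =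
        Fin.cons (γ .i (etaWk (HSort.iotas n) .zero)) fun k => γ .i (etaInd n k) := by
      funext k
      refine Fin.cases rfl (fun k => rfl) k
    rw [e]
    rfl

/-- The denotation of the lift of a terminal. -/
def symSem (f : Sg.Sym) : MDom (BTree Sg) (relPos (HSort.iotas (Sg.arity f))) :=
  curryInd (A := BTree Sg) (Sg.arity f) fun xs => MDom.ofPred fun r =>
    (RTree.node (S := Sg.withBot) (some f) xs : BTree Sg) = r

theorem sem_symGoal {V : Type} {Δ : V → RSort} {Γ' : List ASort} (f : Sg.Sym)
    (β : REnv (BTree Sg) Δ) (γ : MEnv (BTree Sg) Γ') :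
    (symGoal (Sg := Sg) (Δ := Δ) f).sem (BTree Sg) (β, γ) = symSem f := by
  refine sem_etaLam _ _ β γ _ fun γ' _ => ?_
  refine Iff.trans ?_ (fullApp_curryInd _ _ γ').symm
  exact FirstOrder.Language.Formula.realize_equal

/-- The denotation of the lift of a variable with value `x`. -/
def varSem {A : Type} : (a : HSort) → MArg A (relNeg a) → MDom A (relPos a)
  | .i, x => MDom.ofPred fun r => (show A from x) = r
  | .arr _ _, x => x

/-- The value of `⟦(e, r)⟧`, where `E` is the denotation of the lift of `e`. -/
def argSem {A : Type} : (a : HSort) → MDom A (relPos a) → MArg A (relNeg a) → MArg A (relNeg a)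
  | .i, _, r => r
  | .arr _ _, E, _ => E

/-- The value of `Prop(e, r)`, where `E` is the denotation of the lift of `e`. -/
def propSem {A : Type} : (a : HSort) → MDom A (relPos a) → MArg A (relNeg a) → Prop
  | .i, E, r => predApp E r
  | .arr _ _, _, _ => True

theorem sem_trueGoal {V : Type} {Δ : V → RSort} {Γ' : List ASort} (β : REnv (BTree Sg) Δ)
    (γ : MEnv (BTree Sg) Γ') :
    (trueGoal : Goal (treeLang Sg.withBot) Δ Γ' .o).sem (BTree Sg) (β, γ) = True :=
  propext ⟨fun _ => trivial, fun _ => FirstOrder.Language.Formula.realize_top.2 trivial⟩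

theorem sem_varGoal {V : Type} {Δ : V → RSort} {Γ' : List ASort} (a : HSort)
    (x : Var Γ' (relNeg a)) (β : REnv (BTree Sg) Δ) (γ : MEnv (BTree Sg) Γ') :
    (varGoal a x : Goal (treeLang Sg.withBot) Δ Γ' (relPos a)).sem (BTree Sg) (β, γ) =
      varSem a (γ _ x) := by
  cases a with
  | i => exact relPos_ext fun t => FirstOrder.Language.Formula.realize_equal
  | arr a b => rfl

theorem sem_appLift {V : Type} {Δ : V → RSort} {Γ' : List ASort} (a b : HSort)
    (G : Goal (treeLang Sg.withBot) Δ Γ' (relPos (.arr a b)))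
    (E : Goal (treeLang Sg.withBot) Δ Γ' (relPos a)) (r : Var Γ' (relNeg a))
    (β : REnv (BTree Sg) Δ) (γ : MEnv (BTree Sg) Γ') :
    (appLift a b G E r).sem (BTree Sg) (β, γ) =
      relApp (G.sem (BTree Sg) (β, γ)) (argSem a (E.sem (BTree Sg) (β, γ)) (γ _ r)) := by
  cases a <;> rfl

theorem sem_propLift {V : Type} {Δ : V → RSort} {Γ' : List ASort} (a : HSort)
    (E : Goal (treeLang Sg.withBot) Δ Γ' (relPos a)) (r : Var Γ' (relNeg a))
    (β : REnv (BTree Sg) Δ) (γ : MEnv (BTree Sg) Γ') :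
    ((propLift a E r).sem (BTree Sg) (β, γ)).Holds ↔
      propSem a (E.sem (BTree Sg) (β, γ)) (γ _ r) := by
  cases a with
  | i => exact Iff.rfl
  | arr a b => exact iff_of_eq (sem_trueGoal β γ)

-- The lift by structural recursion, and its agreement with the goal terms

/-- The denotation of the lift of `e`, by recursion on `e`. -/
def liftSem (β : REnv (BTree Sg) (relEnv NT)) (δ : ∀ τ, Var Γ τ → MArg (BTree Sg) (relNeg τ)) :
    {σ : HSort} → HTerm Sg NT Γ σ → MDom (BTree Sg) (relPos σ)
  | σ, .var x => varSem σ (δ σ x)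
  | _, .term f => symSem f
  | σ, .nonterm F => β ⟨σ, F⟩
  | _, .app (a := a) (b := b) s e =>
    -- At sort `ι` the index ranges over the trees satisfying the lifted argument; at a function
    -- sort it is a dummy, as neither the condition nor the value depends on it.
    ⨆ (r : MArg (BTree Sg) (relNeg a)) (_ : propSem a (liftSem β δ e) r),
      relApp (liftSem β δ s) (argSem a (liftSem β δ e) r)

/-- The denotation of the terms in `liftCore e`. -/
def coreSem (β : REnv (BTree Sg) (relEnv NT)) (δ : ∀ τ, Var Γ τ → MArg (BTree Sg) (relNeg τ)) :
    {σ : HSort} → (e : HTerm Sg NT Γ σ) → ArgVals (BTree Sg) e →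
      MDom (BTree Sg) (relPos σ) × Prop
  | _, .app (a := a) (b := b) s e, v =>
    (relApp (coreSem β δ s v.1).1
        (argSem a (liftSem β δ e) v.2),
      (coreSem β δ s v.1).2 ∧ propSem a (liftSem β δ e) v.2)
  | σ, .var x, _ => (varSem σ (δ σ x), True)
  | _, .term f, _ => (symSem f, True)
  | σ, .nonterm F, _ => (β ⟨σ, F⟩, True)

/-- The encoding quantifies all `r₁, …, rₗ` of a spine in one block, whereas `liftSem` quantifies at
each application. The two agree because application commutes with suprema in the function position.
-/
theorem iSup_coreSem (β : REnv (BTree Sg) (relEnv NT))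
    (δ : ∀ τ, Var Γ τ → MArg (BTree Sg) (relNeg τ)) {σ : HSort} (e : HTerm Sg NT Γ σ) :
    ⨆ (v : ArgVals (BTree Sg) e) (_ : (coreSem β δ e v).2), (coreSem β δ e v).1 =
      liftSem β δ e := by
  have triv : ∀ {σ : HSort} (R : MDom (BTree Sg) (relPos σ)),
      ⨆ (_ : Unit) (_ : True), R = R := fun R => by simp
  induction e with
  | var x => exact triv _
  | term f => exact triv _
  | nonterm F => exact triv _
  | @app a b s e ihs _ =>
    change _ = ⨆ (r : MArg (BTree Sg) (relNeg a)) (_ : propSem a (liftSem β δ e) r),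
      relApp (liftSem β δ s) (argSem a (liftSem β δ e) r)
    rw [← ihs]
    refine le_antisymm ?_ ?_
    · refine iSup_le fun v => iSup_le fun hv => ?_
      refine le_iSup_of_le v.2 (le_iSup_of_le hv.2 ?_)
      simp only [relApp_iSup]
      exact le_iSup_of_le v.1 (le_iSup_of_le hv.1 le_rfl)
    · refine iSup_le fun r => iSup_le fun hr => ?_
      simp only [relApp_iSup]
      refine iSup_le fun v => iSup_le fun hv => ?_
      exact le_iSup_of_le (ι := ArgVals (BTree Sg) (.app s e)) (v, r)
        (le_iSup_of_le (⟨hv, hr⟩ : (coreSem β δ (.app s e) (v, r)).2) le_rfl)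

/-- The hypothesis on `core` ranges over all contexts in which the clones keep their values, since
`core` is evaluated beneath both the abstractions and the quantifiers. -/
theorem sem_closeLift {σ : HSort} (e : HTerm Sg NT Γ σ)
    (core : (Γ'' : List ASort) → Clones Γ Γ'' → ArgVars Γ'' e →
      TreeGoal Sg NT Γ'' (relPos σ) × TreeGoal Sg NT Γ'' .o)
    (β : REnv (BTree Sg) (relEnv NT)) {Γ' : List ASort} (ξ : Clones Γ Γ')
    (γ : MEnv (BTree Sg) Γ') (K : ArgVals (BTree Sg) e → MDom (BTree Sg) (relPos σ) × Prop)
    (hK : ∀ (Γ'' : List ASort) (ξ' : Clones Γ Γ'') (r : ArgVars Γ'' e) (γ' : MEnv (BTree Sg) Γ''),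
      (∀ τ x, γ' _ (ξ' τ x) = γ _ (ξ τ x)) →
      (core Γ'' ξ' r).1.sem (BTree Sg) (β, γ') = (K (r.vals γ')).1 ∧
      (core Γ'' ξ' r).2.sem (BTree Sg) (β, γ') = (K (r.vals γ')).2) :
    (closeLift e core ξ).sem (BTree Sg) (β, γ) =
      ⨆ (v : ArgVals (BTree Sg) e) (_ : (K v).2), (K v).1 := by
  refine sem_etaLam _ _ β γ _ fun γ' hγ' => ?_
  rw [fullApp_iSup]
  refine (sem_exAll e _ β γ').trans (exists_congr fun v => ?_)
  rw [fullApp_iSup]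
  obtain ⟨h1, h2⟩ := hK _ (fun τ x => exWk e _ (etaWk σ (ξ τ x))) (exVars e _) (exEnv e γ' v)
    fun τ x => (exEnv_exWk e γ' v _ _).trans (hγ' _ _)
  rw [vals_exVars] at h1 h2
  refine Iff.trans (Iff.and (sem_etaApp σ _ _ β _) (iff_of_eq h2)) ?_
  rw [h1]
  have e1 : (fun s x => exEnv e γ' v s (exWk e s x)) = γ' :=
    funext fun s => funext fun x => exEnv_exWk e γ' v s x
  rw [e1]
  -- The goal lists the application before the side conditions; the iterated supremum has the
  -- condition outside.
  exact ⟨fun h => ⟨h.2, h.1⟩, fun ⟨h, h'⟩ => ⟨h', h⟩⟩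

/-- The core of an application contains the closed lift of its argument. Taking the claim about
`liftCore e` as a premise lets this serve inside the induction of `sem_liftCore` as well as after
it. -/
theorem sem_closeLift_liftCore {σ : HSort} (e : HTerm Sg NT Γ σ)
    (β : REnv (BTree Sg) (relEnv NT)) {Γ' : List ASort} (ξ : Clones Γ Γ')
    (γ : MEnv (BTree Sg) Γ')
    (h : ∀ (Γ'' : List ASort) (ξ' : Clones Γ Γ'') (r : ArgVars Γ'' e) (γ' : MEnv (BTree Sg) Γ''),
      (liftCore e Γ'' ξ' r).1.sem (BTree Sg) (β, γ') =
          (coreSem β (fun τ x => γ' _ (ξ' τ x)) e (r.vals γ')).1 ∧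
        (liftCore e Γ'' ξ' r).2.sem (BTree Sg) (β, γ') =
          (coreSem β (fun τ x => γ' _ (ξ' τ x)) e (r.vals γ')).2) :
    (closeLift e (liftCore e) ξ).sem (BTree Sg) (β, γ) =
      liftSem β (fun τ x => γ _ (ξ τ x)) e := by
  rw [← iSup_coreSem]
  refine sem_closeLift e _ β ξ γ _ fun Γ'' ξ' r' γ' hγ => ?_
  have e' : (fun τ x => γ _ (ξ τ x)) = fun τ (x : Var Γ τ) => γ' _ (ξ' τ x) :=
    funext fun τ => funext fun x => (hγ τ x).symm
  rw [e']
  exact h Γ'' ξ' r' γ'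

theorem sem_liftCore (β : REnv (BTree Sg) (relEnv NT)) {σ : HSort} (e : HTerm Sg NT Γ σ)
    {Γ' : List ASort} (ξ : Clones Γ Γ') (r : ArgVars Γ' e) (γ : MEnv (BTree Sg) Γ') :
    (liftCore e Γ' ξ r).1.sem (BTree Sg) (β, γ) =
        (coreSem β (fun τ x => γ _ (ξ τ x)) e (r.vals γ)).1 ∧
      (liftCore e Γ' ξ r).2.sem (BTree Sg) (β, γ) =
        (coreSem β (fun τ x => γ _ (ξ τ x)) e (r.vals γ)).2 := by
  have htrue := sem_trueGoal (Sg := Sg) β γ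
  induction e generalizing Γ' with
  | var x =>
    refine ⟨?_, htrue⟩
    exact sem_varGoal _ _ β γ
  | term f => exact ⟨sem_symGoal f β γ, htrue⟩
  | nonterm F => exact ⟨rfl, htrue⟩
  | @app a b s e ihs ihe =>
    obtain ⟨h1, h2⟩ := ihs ξ r.1 γ htrue
    have hE := sem_closeLift_liftCore e β ξ γ fun Γ'' ξ' r' γ' => ihe ξ' r' γ' (sem_trueGoal β γ')
    constructor
    · refine (sem_appLift a b _ _ _ β γ).trans ?_
      rw [h1, hE]
      rfl
    · refine propext (Iff.and (iff_of_eq h2) ?_)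
      refine (sem_propLift a _ _ β γ).trans ?_
      rw [hE]
      rfl

theorem HTerm.sem_lift (β : REnv (BTree Sg) (relEnv NT)) {σ : HSort} (e : HTerm Sg NT Γ σ)
    {Γ' : List ASort} (ξ : Clones Γ Γ') (γ : MEnv (BTree Sg) Γ') :
    (e.lift ξ).sem (BTree Sg) (β, γ) = liftSem β (fun τ x => γ _ (ξ τ x)) e :=
  sem_closeLift_liftCore e β ξ γ fun _ ξ' r' γ' => sem_liftCore β e ξ' r' γ'

end LiftSem

/-! ## Logical relations between the two semantics -/

/-- Base relations on individuals from which a logical relation between the interpretations of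
`σ` and of `Rel⁺(σ)`, `Rel⁻(σ)` can be built that is respected by the relational lift. -/
structure BaseRel (Sg : RankedAlphabet) where
  -- `var` and `bind` ask that `pos` and `neg` respect singletons and unions indexed by a set of
  -- trees, the unit and bind of the powerset monad; `bind` is what applying a function to an
  -- argument of sort `ι` requires.
  pos : BTree Sg → MDom (BTree Sg) (relPos .i) → Prop
  neg : BTree Sg → BTree Sg → Prop
  var : ∀ {d x}, neg d x → pos d (MDom.ofPred fun r => x = r)
  node : ∀ (f : Sg.Sym) {ds xs : Fin (Sg.arity f) → BTree Sg}, (∀ k, neg (ds k) (xs k)) →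
    pos (RTree.node (S := Sg.withBot) (some f) ds)
      (MDom.ofPred fun r => (RTree.node (S := Sg.withBot) (some f) xs : BTree Sg) = r)
  bind : ∀ {d E d'} {K : BTree Sg → MDom (BTree Sg) (relPos .i)}, pos d E →
    (∀ r, neg d r → pos d' (K r)) → pos d' (⨆ (r : BTree Sg) (_ : predApp E r), K r)

namespace BaseRel

variable {Sg : RankedAlphabet} (B : BaseRel Sg)

mutual

/-- The logical relation at `Rel⁺(σ)`. -/
def posRel : (σ : HSort) → HDom Sg σ → MDom (BTree Sg) (relPos σ) → Prop
  | .i, d, R => B.pos d R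
  | .arr a b, f, R => ∀ (d : HDom Sg a) (x : MArg (BTree Sg) (relNeg a)), negRel a d x →
      posRel b (f.app d) (relApp R x)

/-- The logical relation at `Rel⁻(σ)`. -/
def negRel : (σ : HSort) → HDom Sg σ → MArg (BTree Sg) (relNeg σ) → Prop
  | .i, d, x => B.neg d x
  -- `Rel⁺` and `Rel⁻` coincide at function sorts, hence the clause is that of `posRel`.
  | .arr a b, f, R => ∀ (d : HDom Sg a) (x : MArg (BTree Sg) (relNeg a)), negRel a d x →
      posRel b (f.app d) (relApp (a := a) (b := b) R x)

end

-- The fundamental lemma of the logical relation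

theorem posRel_varSem (a : HSort) {d : HDom Sg a} {x : MArg (BTree Sg) (relNeg a)}
    (h : B.negRel a d x) : B.posRel a d (varSem a x) := by
  cases a with
  | i => exact B.var h
  | arr a b => exact h

/-- Suprema of relations are pointwise, so `bind` passes from `ι` to every result sort. -/
theorem posRel_bind (σ : HSort) {d : BTree Sg} {E : MDom (BTree Sg) (relPos .i)}
    {d' : HDom Sg σ} {K : BTree Sg → MDom (BTree Sg) (relPos σ)} (hE : B.pos d E)
    (hK : ∀ r, B.neg d r → B.posRel σ d' (K r)) :
    B.posRel σ d' (⨆ (r : BTree Sg) (_ : predApp E r), K r) := by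
  induction σ with
  | i => exact B.bind hE hK
  | arr a b _ ihb =>
    intro y x hx
    simp only [relApp_iSup]
    exact ihb fun r hr => hK r hr y x hx

theorem posRel_app {a b : HSort} {f : HDom Sg (.arr a b)} {d : HDom Sg a}
    {R : MDom (BTree Sg) (relPos (.arr a b))} {E : MDom (BTree Sg) (relPos a)}
    (hf : B.posRel (.arr a b) f R) (hd : B.posRel a d E) :
    B.posRel b (f.app d)
      (⨆ (r : MArg (BTree Sg) (relNeg a)) (_ : propSem a E r), relApp R (argSem a E r)) := by
  cases a with
  | i => exact B.posRel_bind b hd fun r hr => hf d r hr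
  | arr a₁ a₂ =>
    -- The dummy supremum is over a constant family and collapses to its value only because the
    -- index type is inhabited; an empty one would give the bottom element.
    have : Nonempty (MArg (BTree Sg) (relNeg (.arr a₁ a₂))) := ⟨E⟩
    have e : (⨆ (r : MArg (BTree Sg) (relNeg (.arr a₁ a₂))) (_ : propSem (.arr a₁ a₂) E r),
        relApp R (argSem (.arr a₁ a₂) E r)) = relApp (a := .arr a₁ a₂) (b := b) R E :=
      (iSup_congr fun _ => iSup_pos trivial).trans
        (iSup_const (ι := MArg (BTree Sg) (relNeg (.arr a₁ a₂)))
          (a := relApp (a := .arr a₁ a₂) (b := b) R E))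
    rw [e]
    exact hf d E hd

/-- The parameter space `C` varies in the induction because `curryTrees` moves each consumed
argument into it. -/
theorem posRel_curry (n : ℕ) {C : Type} [PartialOrder C]
    (g : ContFun (C × (Fin n → BTree Sg)) (BTree Sg)) (c : C)
    (h : (Fin n → BTree Sg) → MDom (BTree Sg) (.arr .i .o))
    (hgh : ∀ ds xs : Fin n → BTree Sg, (∀ k, B.neg (ds k) (xs k)) → B.pos (g (c, ds)) (h xs)) :
    B.posRel (HSort.iotas n) (curryTrees n g c) (curryInd n h) := by
  induction n generalizing C with
  | zero => exact hgh _ _ fun k => k.elim0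
  | succ n ih =>
    intro d x hx
    refine ih _ (c, d) _ fun ds xs hk => ?_
    exact hgh _ _ (Fin.cases hx hk)

theorem posRel_symSem (f : Sg.Sym) : B.posRel (HSort.iotas (Sg.arity f)) (herbrand f) (symSem f) :=
  B.posRel_curry _ _ _ _ fun _ _ h => B.node f h

variable {NT : HSort → Type} {α : NEnv Sg NT} {β : REnv (BTree Sg) (relEnv NT)}

/-- The relational lift of a term is related to the term. -/
theorem posRel_liftSem (hαβ : ∀ σ (F : NT σ), B.posRel σ (α σ F) (β ⟨σ, F⟩)) {Γ : List HSort}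
    {γ : HEnv Sg Γ} {δ : ∀ τ, Var Γ τ → MArg (BTree Sg) (relNeg τ)}
    (hγδ : ∀ τ x, B.negRel τ (γ τ x) (δ τ x)) {σ : HSort} (e : HTerm Sg NT Γ σ) :
    B.posRel σ (e.sem α γ) (liftSem β δ e) := by
  induction e with
  | var x => exact B.posRel_varSem _ (hγδ _ x)
  | term f => exact B.posRel_symSem f
  | nonterm F => exact hαβ _ F
  | app s e ihs ihe => exact B.posRel_app ihs ihe

/-- The relational lift of a right-hand side is related to the right-hand side. -/
theorem posRel_rule (hαβ : ∀ σ (F : NT σ), B.posRel σ (α σ F) (β ⟨σ, F⟩)) {Γ : List HSort}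
    {σ : HSort} (r : HRule Sg NT Γ σ) {Γ' : List ASort} (ξ : Clones Γ Γ') {γ : HEnv Sg Γ}
    {δ : MEnv (BTree Sg) Γ'} (hγδ : ∀ τ x, B.negRel τ (γ τ x) (δ _ (ξ τ x))) :
    B.posRel σ (r.sem (α, γ)) ((r.lift ξ).sem (BTree Sg) (β, δ)) := by
  induction r generalizing Γ' with
  | body e =>
    have := B.posRel_liftSem hαβ hγδ e
    rw [← HTerm.sem_lift β e ξ δ] at this
    exact this
  | lam r ih =>
    intro d x hx
    refine ih _ (γ := extendEnv γ d) (δ := extendEnv δ x) fun τ y => ?_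
    cases y with
    | zero => exact hx
    | succ y => exact hγδ τ y

/-- One step of the scheme is related to one step of its encoding. -/
theorem posRel_step (G : HoRS Sg) {α : NEnv Sg G.NT} {β : REnv (BTree Sg) (relEnv G.NT)}
    (hαβ : ∀ σ (F : G.NT σ), B.posRel σ (α σ F) (β ⟨σ, F⟩)) (σ : HSort) (F : G.NT σ) :
    B.posRel σ (G.step α σ F) (G.encoding.oneStep (BTree Sg) β ⟨σ, F⟩) :=
  B.posRel_rule hαβ (G.rule F) _ fun _ x => nomatch x

-- The two instances: lower bounds and membership

/-- The base relations for approximation from below. -/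
def below (Sg : RankedAlphabet) : BaseRel Sg where
  pos d R := ∀ t, predApp R t → d ≤ t
  neg d x := d ≤ x
  var h t ht := h.trans (le_of_eq ht)
  node f _ _ h t ht := ((RTree.scottContinuous_node f).monotone h).trans (le_of_eq ht)
  bind hE hK t ht := by
    obtain ⟨r, hr⟩ := (predApp_iSup _ t).1 ht
    obtain ⟨hEr, ht⟩ := (predApp_iSup _ t).1 hr
    exact hK r (hE r hEr) t ht

/-- The base relations for membership. -/
def mem (Sg : RankedAlphabet) : BaseRel Sg where
  pos d R := predApp R d
  neg d x := x = d
  var h := h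
  node f _ _ h := congrArg (RTree.node (S := Sg.withBot) (some f)) (funext h)
  bind {d _ _ _} hE hK :=
    -- The existential is witnessed by the value `d` of the argument itself.
    (predApp_iSup _ _).2 ⟨d, (predApp_iSup _ _).2 ⟨hE, hK d rfl⟩⟩

/-- Start of the induction along the Kleene chain: `⊥` is below everything, whatever the relation on
the other side. -/
theorem posRel_below_bot (σ : HSort) (R : MDom (BTree Sg) (relPos σ)) :
    (below Sg).posRel σ ⊥ R := by
  induction σ with
  | i => exact fun _ _ => bot_le
  | arr a b _ ihb =>
    intro d x _
    have e : HDom.app (⊥ : HDom Sg (.arr a b)) d = ⊥ := by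
      refine le_bot_iff.1 ?_
      -- The least element of the function space is not given by a formula; comparison with the
      -- constant function `⊥` shows that it takes the value `⊥` everywhere.
      let g : HDom Sg (.arr a b) :=
        (⟨fun _ => ⊥, ScottContinuous.const _⟩ : ContFun (HDom Sg a) (HDom Sg b))
      exact (show ∀ x, HDom.app (⊥ : HDom Sg (.arr a b)) x ≤ HDom.app g x from
        (bot_le : (⊥ : HDom Sg (.arr a b)) ≤ g)) d
    rw [e]
    exact ihb _

/-- Infima are pointwise and, at sort `ι`, intersections. Hence each `d` has a least relation
related to it. -/
theorem posRel_mem_sInf (σ : HSort) (d : HDom Sg σ) {S : Set (MDom (BTree Sg) (relPos σ))}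
    (h : ∀ R ∈ S, (mem Sg).posRel σ d R) : (mem Sg).posRel σ d (sInf S) := by
  induction σ with
  | i => exact (predApp_sInf S d).2 h
  | arr a b _ ihb =>
    intro y x hx
    rw [relApp_sInf]
    refine ihb _ ?_
    rintro _ ⟨R, hR, rfl⟩
    exact h R hR y x hx

end BaseRel

/-! ## Correctness of the encoding -/

/-- Trees without `⊥` are maximal. Going down from the root, every node of `t` is a node of `s`,
since the parents carry the same label; there `s` has a label in `Σ`, which `t` must share. -/
theorem BTree.BotFree.eq_of_le {Sg : RankedAlphabet} {s t : BTree Sg} (hs : s.BotFree)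
    (h : s ≤ t) : t = s := by
  have key : ∀ w, (t.lab w).isSome → t.lab w = s.lab w := by
    intro w
    induction w using List.reverseRecOn with
    | nil =>
      intro _
      obtain ⟨g, hg⟩ := Option.isSome_iff_exists.1 s.root
      cases g with
      | none => exact absurd hg (hs _)
      | some g => rw [hg, h _ _ hg]
    | append_singleton w i ih =>
      intro hw
      obtain ⟨f, hf, hi⟩ := (BTree.isSome_child t w i).1 hw
      have hsf : s.lab w = some (some f) := by
        rw [← ih (by simp [hf]), hf]
      obtain ⟨g, hg⟩ := Option.isSome_iff_exists.1 ((BTree.isSome_child s w i).2 ⟨f, hsf, hi⟩)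
      cases g with
      | none => exact absurd hg (hs _)
      | some g => rw [hg, h _ _ hg]
  refine le_antisymm (fun w f hf => ?_) h
  rw [← key w (by simp [hf]), hf]

namespace HoRS

variable {Sg : RankedAlphabet} (G : HoRS Sg)

/-- Every solution of the encoding lies above the tree of the scheme. -/
theorem tree_le_of_gfp {t : BTree Sg}
    (h : predApp ((G.encoding.oneStep (BTree Sg)).gfp ⟨.i, G.start⟩) t) : G.tree ≤ t := by
  have hn : ∀ (n : ℕ) σ (F : G.NT σ), (BaseRel.below Sg).posRel σ ((G.step^[n] ⊥) σ F)
      ((G.encoding.oneStep (BTree Sg)).gfp ⟨σ, F⟩) := by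
    intro n
    induction n with
    | zero => exact fun σ F => BaseRel.posRel_below_bot σ _
    | succ n ih =>
      intro σ F
      -- Only the fixpoint equation of `gfp` is used, so the bound holds at every fixpoint of the
      -- one-step operator.
      rw [Function.iterate_succ_apply', ← OrderHom.map_gfp]
      exact (BaseRel.below Sg).posRel_step G ih σ F
  -- The limit is taken only at `S : ι`, where being a lower bound passes to suprema at once; no
  -- closure under limits at higher sorts is needed.
  have hlub := isLUB_pi.1 (isLUB_pi.1 G.isLUB_lfp .i) G.start
  refine hlub.2 ?_
  rintro _ ⟨_, ⟨_, ⟨n, rfl⟩, rfl⟩, rfl⟩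
  exact hn n .i G.start t h

/-- The tree of the scheme is a solution of the encoding. -/
theorem gfp_tree : predApp ((G.encoding.oneStep (BTree Sg)).gfp ⟨.i, G.start⟩) G.tree := by
  -- The coinduction witness: the least relation related to the value of each nonterminal.
  let β : REnv (BTree Sg) (relEnv G.NT) := fun F =>
    sInf {R | (BaseRel.mem Sg).posRel F.1 (G.lfp F.1 F.2) R}
  have hβ : ∀ σ (F : G.NT σ), (BaseRel.mem Sg).posRel σ (G.lfp σ F) (β ⟨σ, F⟩) :=
    fun σ F => BaseRel.posRel_mem_sInf σ _ fun R hR => hR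
  have hfix : G.step G.lfp = G.lfp := G.isLeast_lfp.1
  have hle : β ≤ G.encoding.oneStep (BTree Sg) β := by
    rintro ⟨σ, F⟩
    -- One step from `β` is related to one step from `G.lfp`, which is `G.lfp` again, so it belongs
    -- to the set whose infimum is `β`.
    refine sInf_le ?_
    have := (BaseRel.mem Sg).posRel_step G hβ σ F
    rw [hfix] at this
    exact this
  have h := (G.encoding.oneStep (BTree Sg)).le_gfp hle ⟨.i, G.start⟩
  exact (show β ⟨.i, G.start⟩ ≤ (G.encoding.oneStep (BTree Sg)).gfp ⟨.i, G.start⟩ from h)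
    G.tree (hβ .i G.start)

end HoRS

theorem mainTheorem1 {Sg : RankedAlphabet} (G : HoRS Sg) (hG : G.tree.BotFree) (t : BTree Sg) :
    (G.startGoal.sem (BTree Sg) ((G.encoding.oneStep (BTree Sg)).gfp, emptyEnv)).app (s := .i) t ↔
      t = G.tree := by
  change predApp ((G.encoding.oneStep (BTree Sg)).gfp ⟨.i, G.start⟩) t ↔ t = G.tree
  exact ⟨fun h => hG.eq_of_le (G.tree_le_of_gfp h), fun h => h ▸ G.gfp_tree⟩
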